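/- **Setting ($q=0$).** Let $\mathcal H$ be the Hilbert space with orthonormal basis $e^{(n)}_{ij}$, where $n\in\frac12\mathbb N$ and $i,j\in\{-n,-n+1,\dots,n\}$. Let $\alpha,\beta$ be the bounded operators on $\mathcal H$ with $\alpha e^{(n)}_{ij}=e^{(n-1/2)}_{i-1/2,\,j-1/2}$ if $i>-n$ and $j>-n$, and $\alpha e^{(n)}_{ij}=0$ otherwise; $\beta e^{(n)}_{i,-n}=-e^{(n+1/2)}_{i+1/2,\,-(n+1/2)}$, $\beta e^{(n)}_{-n,j}=e^{(n-1/2)}_{-(n-1/2),\,j-1/2}$ if $j\neq -n$, and $\beta e^{(n)}_{ij}=0$ if $i\ne -n$ and $j\neq -n$. For $f\in C^\infty(S^1)$ with Fourier coefficients $\hat f_m$ put $f(\beta)=\sum_{m>0}\hat f_m\beta^m+\sum_{m<0}\hat f_m(\beta^*)^{-m}+\hat f_0\,\beta^*\beta$. Let $\mathcal A$ be the set of all sums $$a=\sum_{k,\ell\ge0}\alpha^{*k}f_{k\ell}(\beta)\alpha^\ell+\sum_{\ell\ge0}\lambda_\ell\alpha^\ell+\sum_{k>0}\lambda'_k\alpha^{*k}$$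 with $\lambda,\lambda'$ complex sequences of rapid decay and $(f_{k\ell})$ a double sequence of rapid decay with values in $C^\infty(S^1)$. Let $D$ be the unbounded self-adjoint diagonal operator with $De^{(n)}_{ij}=2n\,e^{(n)}_{ij}$ if $i=n$ and $De^{(n)}_{ij}=-2n\,e^{(n)}_{ij}$ if $i\ne n$; let $\delta(T)=[|D|,T]$, as an unbounded derivation of the bounded operators on $\mathcal H$. Let $\mathcal B$ be the algebra generated by all $\delta^k(a)$ and $\delta^k([D,a])$, $a\in\mathcal A$, $k\ge0$. Fix $\varepsilon>0$, and in $|D|^{-s}$ replace the eigenvalue $0$ of $|D|$ by $\varepsilon$. For $b\in\mathcal B$ and $\operatorname{Re}s>3$ let $\zeta_b(s)=\operatorname{Trace}(b|D|^{-s})$. **Theorem 2.** For every $a\in\mathcal A$ the commutator $[D,a]$ is bounded, and $a$ and $[D,a]$ are in the domain of $\delta^k$ for all $k$. For every $b\in\mathcal B$ and $\operatorname{Re}s>3$ the operator $b|D|^{-s}$ is of trace class. The dimension spectrum of $(\mathcal A,\mathcal H,D)$ is simple and equal to $\{1,2,3\}$: every $\zeta_b$, $b\in\mathcal B$, extends to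 a meromorphic function on $\mathbb C$ that is holomorphic off $\{1,2,3\}$ and has at most simple poles at $1,2,3$, and for each of these three points there is a $b\in\mathcal B$ for which $\zeta_b$ is singular there. In fact, for every $b\in\mathcal B$ there are scalars $\lambda_1,\lambda_2,\lambda_3\in\mathbb C$, independent of $\varepsilon$, and an entire function $\rho$ with $$\zeta_b(s)=\lambda_3\,\zeta(s-2)+\lambda_2\,\zeta(s-1)+\lambda_1\,\zeta(s)+\rho(s)\qquad(\operatorname{Re}s>3),$$ where $\zeta$ is the Riemann zeta function. -/

import Mathlib

open scoped ContDiff InnerProductSpace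

noncomputable section

namespace QuantumSU2

/-! ### The Hilbert space -/

/-- Labels of the orthonormal basis `e^{(n)}_{ij}`, with `n ∈ {0, 1/2, 1, …}` and
`i, j ∈ {-n, -n+1, …, n}`.  The half-integers are encoded by the natural numbers
`N = 2n`, `x = i + n`, `y = j + n`, so that `0 ≤ x, y ≤ N`.  Thus `i = -n` reads `x = 0`,
`i = n` reads `x = N`, and `j = -n` reads `y = 0`. -/
@[ext] structure Idx where
  N : ℕ
  x : ℕ
  y : ℕ
  hx : x ≤ N
  hy : y ≤ N

/-- The Hilbert space with orthonormal basis `e^{(n)}_{ij}`. -/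
abbrev H : Type := lp (fun _ : Idx => ℂ) 2

theorem H_ext {ξ η : H} (h : ∀ i, ξ i = η i) : ξ = η := lp.ext (funext h)

open Classical in
/-- The basis vector with label `i`. -/
def e (i : Idx) : H := lp.single 2 i (1 : ℂ)

open Classical in
theorem e_apply (i j : Idx) : e i j = if j = i then 1 else 0 := by
  simp [e, Pi.single_apply]

/-! ### Bounded operators given by coordinates -/

theorem weightedPull_sum_le (c : Idx → ℂ) (φ : Idx → Idx) (C : ℝ) (hc : ∀ i, ‖c i‖ ≤ C)
    (hφ : Set.InjOn φ (Function.support c)) (ξ : H) (s : Finset Idx) :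
    ∑ i ∈ s, ‖c i * ξ (φ i)‖ ^ (2 : ENNReal).toReal ≤ (C * ‖ξ‖) ^ (2 : ENNReal).toReal := by
  classical
  have h2 : (2 : ENNReal).toReal = ((2 : ℕ) : ℝ) := by simp
  have key := lp.sum_rpow_le_norm_rpow (p := 2) (by norm_num) ξ ((s.filter (c · ≠ 0)).image φ)
  simp only [h2, Real.rpow_natCast] at key ⊢
  rw [Finset.sum_image] at key
  · calc ∑ i ∈ s, ‖c i * ξ (φ i)‖ ^ 2
        = ∑ i ∈ s.filter (c · ≠ 0), ‖c i * ξ (φ i)‖ ^ 2 := by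
          symm
          apply Finset.sum_subset (Finset.filter_subset _ _)
          intro i hi hi'
          have : c i = 0 := by simpa [hi] using hi'
          simp [this]
      _ ≤ ∑ i ∈ s.filter (c · ≠ 0), C ^ 2 * ‖ξ (φ i)‖ ^ 2 := by
          apply Finset.sum_le_sum
          intro i _
          rw [norm_mul, mul_pow]
          have := hc i
          gcongr
      _ ≤ (C * ‖ξ‖) ^ 2 := by
          rw [← Finset.mul_sum, mul_pow]
          gcongr
  · intro i hi j hj hij
    exact hφ (by simpa using (Finset.mem_filter.mp hi).2)
      (by simpa using (Finset.mem_filter.mp hj).2) hij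

/-- The bounded operator `ξ ↦ (i ↦ c i * ξ (φ i))`, for bounded weights `c` and a map `φ` that is
injective where `c` does not vanish. -/
def weightedPull (c : Idx → ℂ) (φ : Idx → Idx) (C : ℝ) (hc : ∀ i, ‖c i‖ ≤ C)
    (hφ : Set.InjOn φ (Function.support c)) : H →L[ℂ] H :=
  LinearMap.mkContinuous
    { toFun := fun ξ =>
        ⟨fun i => c i * ξ (φ i), memℓp_gen' (weightedPull_sum_le c φ C hc hφ ξ)⟩
      map_add' := fun ξ η => by ext i; exact mul_add _ _ _
      map_smul' := fun z ξ => by ext i; simp [mul_left_comm] }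
    |C|
    (fun ξ => by
      refine lp.norm_le_of_forall_sum_le (by norm_num) (by positivity) fun s => ?_
      exact weightedPull_sum_le c φ |C| (fun i => (hc i).trans (le_abs_self C)) hφ ξ s)

theorem weightedPull_apply (c : Idx → ℂ) (φ : Idx → Idx) (C : ℝ) (hc : ∀ i, ‖c i‖ ≤ C)
    (hφ : Set.InjOn φ (Function.support c)) (ξ : H) (i : Idx) :
    weightedPull c φ C hc hφ ξ i = c i * ξ (φ i) := rfl

open Classical in
/-- The diagonal operator with eigenvalues `w`, when `w` is bounded (and `0` otherwise). -/
def boundedDiag (w : Idx → ℂ) : H →L[ℂ] H :=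
  if h : ∃ C : ℝ, ∀ i, ‖w i‖ ≤ C then
    weightedPull w id h.choose h.choose_spec (Function.injective_id.injOn)
  else 0

theorem boundedDiag_apply {w : Idx → ℂ} (h : ∃ C : ℝ, ∀ i, ‖w i‖ ≤ C) (ξ : H) (i : Idx) :
    boundedDiag w ξ i = w i * ξ i := by
  rw [boundedDiag, dif_pos h]; rfl

/-! ### The generators `α`, `β` at `q = 0` -/

/-- The operator `α`, written in coordinates; `alpha_e` gives its action on the basis. -/
def alpha : H →L[ℂ] H :=
  weightedPull (fun _ => 1)
    (fun t => ⟨t.N + 1, t.x + 1, t.y + 1, Nat.succ_le_succ t.hx, Nat.succ_le_succ t.hy⟩) 1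
    (fun _ => by simp)
    (by
      rintro ⟨N, x, y, _, _⟩ _ ⟨N', x', y', _, _⟩ _ h
      simpa using h)

/-- The coordinates of `β ξ` are those of `ξ` at shifted labels, up to sign; `beta_e` gives the
action of `β` on the basis. -/
def beta : H →L[ℂ] H :=
  weightedPull
    (fun t => if t.x = 0 then 1 else if t.y = 0 then -1 else 0)
    (fun t => if t.x = 0 then ⟨t.N + 1, 0, t.y + 1, Nat.zero_le _, Nat.succ_le_succ t.hy⟩
      else ⟨t.N - 1, t.x - 1, 0, Nat.sub_le_sub_right t.hx 1, Nat.zero_le _⟩) 1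
    (fun t => by split_ifs <;> simp)
    (by
      rintro ⟨N, x, y, _, _⟩ h1 ⟨N', x', y', _, _⟩ h2 h
      simp only [Function.mem_support] at h1 h2
      split_ifs at h h1 h2 <;> simp_all
      omega)

theorem alpha_apply (ξ : H) (t : Idx) :
    alpha ξ t =
      ξ ⟨t.N + 1, t.x + 1, t.y + 1, Nat.succ_le_succ t.hx, Nat.succ_le_succ t.hy⟩ :=
  (weightedPull_apply _ _ _ _ _ _ _).trans (one_mul _)

/-- `α e^{(n)}_{ij} = e^{(n-1/2)}_{i-1/2, j-1/2}` if `i > -n` and `j > -n`, and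
`α e^{(n)}_{ij} = 0` otherwise. -/
theorem alpha_e (t : Idx) :
    alpha (e t) = if 0 < t.x ∧ 0 < t.y then
      e ⟨t.N - 1, t.x - 1, t.y - 1, Nat.sub_le_sub_right t.hx 1, Nat.sub_le_sub_right t.hy 1⟩
    else 0 := by
  obtain ⟨N, x, y, hx, hy⟩ := t
  refine H_ext fun ⟨M, u, v, hu, hv⟩ => ?_
  refine (alpha_apply _ _).trans ?_
  rw [e_apply]
  split_ifs with h1 h2 h2
  · rw [e_apply, if_pos]
    simp only [Idx.mk.injEq] at h1 ⊢
    omega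
  · simp only [Idx.mk.injEq] at h1 h2
    omega
  · rw [e_apply, if_neg]
    simp only [Idx.mk.injEq] at h1 h2 ⊢
    omega
  · rfl

theorem beta_apply (ξ : H) (t : Idx) :
    beta ξ t = if t.x = 0 then ξ ⟨t.N + 1, 0, t.y + 1, Nat.zero_le _, Nat.succ_le_succ t.hy⟩
      else if t.y = 0 then -ξ ⟨t.N - 1, t.x - 1, 0, Nat.sub_le_sub_right t.hx 1, Nat.zero_le _⟩
      else 0 := by
  refine (weightedPull_apply _ _ _ _ _ _ _).trans ?_
  by_cases h : t.x = 0
  · simp only [h, if_true, one_mul]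
  · by_cases h' : t.y = 0
    · simp only [h, h', if_true, if_false, neg_mul, one_mul]
    · simp only [h, h', if_false, zero_mul]

/-- `β e^{(n)}_{i,-n} = - e^{(n+1/2)}_{i+1/2, -(n+1/2)}`;
`β e^{(n)}_{-n,j} = e^{(n-1/2)}_{-(n-1/2), j-1/2}` if `j ≠ -n`; and `β e^{(n)}_{ij} = 0` if
`i ≠ -n` and `j ≠ -n`. -/
theorem beta_e (t : Idx) :
    beta (e t) = if t.y = 0 then
      -e ⟨t.N + 1, t.x + 1, 0, Nat.succ_le_succ t.hx, Nat.zero_le _⟩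
    else if t.x = 0 then
      e ⟨t.N - 1, 0, t.y - 1, Nat.zero_le _, Nat.sub_le_sub_right t.hy 1⟩
    else 0 := by
  obtain ⟨N, x, y, hx, hy⟩ := t
  refine H_ext fun ⟨M, u, v, hu, hv⟩ => (beta_apply _ _).trans ?_
  by_cases hy0 : y = 0
  · rw [if_pos hy0, lp.coeFn_neg, Pi.neg_apply]
    simp only [e_apply, Idx.mk.injEq]
    split_ifs <;> first | omega | simp
  · rw [if_neg hy0]
    by_cases hx0 : x = 0
    · rw [if_pos hx0]
      simp only [e_apply, Idx.mk.injEq]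
      split_ifs <;> first | omega | simp
    · rw [if_neg hx0]
      simp only [e_apply, Idx.mk.injEq]
      split_ifs <;> first | omega | rfl | exact neg_zero

/-! ### The smooth algebra `𝒜` -/

/-- `β^m` for `m > 0`, `(β*)^{-m}` for `m < 0`, and for `m = 0` the projection
`β* β = β β*` onto the span of the basis vectors with `i = -n` or `j = -n`. -/
def betaPow (m : ℤ) : H →L[ℂ] H :=
  if m = 0 then star beta * beta
  else if 0 < m then beta ^ m.toNat
  else star beta ^ (-m).toNat

/-- `f(β) = ∑ₘ f̂(m) βᵐ` for a `2π`-periodic function `f` of the real variable `θ`, where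
`f(θ) = ∑ₘ f̂(m) e^{imθ}`. -/
def funBeta (f : ℝ → ℂ) : H →L[ℂ] H :=
  ∑' m : ℤ, fourierCoeffOn Real.two_pi_pos f m • betaPow m

/-- Smooth functions on the circle, as `2π`-periodic smooth functions on the line. -/
def IsSmoothCircle (f : ℝ → ℂ) : Prop :=
  Function.Periodic f (2 * Real.pi) ∧ ContDiff ℝ ∞ f

/-- A sequence of complex numbers of rapid decay. -/
def RapidDecay (l : ℕ → ℂ) : Prop :=
  ∀ r : ℕ, ∃ C : ℝ, ∀ k : ℕ, (1 + (k : ℝ)) ^ r * ‖l k‖ ≤ C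

/-- A double sequence of smooth functions on the circle, of rapid decay in the Fréchet space
`C^∞(S¹)` with its seminorms `f ↦ sup |f^{(j)}|`. -/
def RapidDecaySmooth (f : ℕ → ℕ → ℝ → ℂ) : Prop :=
  (∀ k l, IsSmoothCircle (f k l)) ∧
    ∀ r j : ℕ, ∃ C : ℝ, ∀ (k l : ℕ) (θ : ℝ),
      (1 + (k : ℝ) + (l : ℝ)) ^ r * ‖iteratedDeriv j (f k l) θ‖ ≤ C

/-- The algebra `𝒜` of all sums
`∑_{k,l ≥ 0} α*ᵏ f_{kl}(β) αˡ + ∑_{l ≥ 0} λ_l αˡ + ∑_{k > 0} λ'_k α*ᵏ`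
with coefficients of rapid decay (these series converge absolutely in norm). -/
def smoothAlg : Set (H →L[ℂ] H) :=
  {a | ∃ (f : ℕ → ℕ → ℝ → ℂ) (lam lam' : ℕ → ℂ),
    RapidDecaySmooth f ∧ RapidDecay lam ∧ RapidDecay lam' ∧
    a = (∑' p : ℕ × ℕ, star alpha ^ p.1 * funBeta (f p.1 p.2) * alpha ^ p.2)
      + (∑' l : ℕ, lam l • alpha ^ l)
      + (∑' k : ℕ, lam' k • star alpha ^ (k + 1))}

/-! ### The Dirac operator and the derivation `δ` -/

/-- The (in general unbounded) diagonal operator with eigenvalues `w`, on its maximal domain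
`{ξ : ∑ |w_i ξ_i|² < ∞}`. -/
def diagOp (w : Idx → ℂ) : H →ₗ.[ℂ] H where
  domain :=
    { carrier := {ξ : H | Memℓp (fun i => w i * ξ i) 2}
      add_mem' := fun {ξ η} hξ hη => by
        have h := Memℓp.add hξ hη
        have e1 : ((fun i => w i * ξ i) + fun i => w i * η i) = fun i => w i * (ξ + η) i := by
          funext i; simp [mul_add]
        rw [e1] at h
        exact h
      zero_mem' := by
        have h : Memℓp (0 : Idx → ℂ) 2 := zero_memℓp
        have e1 : (fun i => w i * (0 : H) i) = (0 : Idx → ℂ) := by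
          funext i; simp
        show Memℓp (fun i => w i * (0 : H) i) 2
        rw [e1]; exact h
      smul_mem' := fun z ξ hξ => by
        have h := Memℓp.const_smul hξ z
        have e1 : (z • fun i => w i * ξ i) = fun i => w i * (z • ξ) i := by
          funext i; simp [mul_left_comm]
        rw [e1] at h
        exact h }
  toFun :=
    { toFun := fun ξ => ⟨fun i => w i * (ξ : H) i, ξ.2⟩
      map_add' := fun ξ η => by ext i; exact mul_add _ _ _
      map_smul' := fun z ξ => by ext i; simp [mul_left_comm] }

/-- The eigenvalue `(2 δ₀(n - i) - 1) 2n` of `D` at `e^{(n)}_{ij}`. -/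
def diracEig (t : Idx) : ℝ := if t.x = t.N then (t.N : ℝ) else -(t.N : ℝ)

/-- The diagonal operator `D`. -/
def dirac : H →ₗ.[ℂ] H := diagOp fun t => ((diracEig t : ℝ) : ℂ)

/-- The operator `|D|`, which has eigenvalue `2n` at `e^{(n)}_{ij}`. -/
def absDirac : H →ₗ.[ℂ] H := diagOp fun t => ((|diracEig t| : ℝ) : ℂ)

/-- The bounded operator `T` preserves the domain of `A`, and the commutator `[A, T]`, defined on
that domain, is the restriction of the bounded operator `S`. -/
def IsCommutator (A : H →ₗ.[ℂ] H) (T S : H →L[ℂ] H) : Prop :=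
  ∀ ξ : A.domain, ∃ h : T (ξ : H) ∈ A.domain, A ⟨T (ξ : H), h⟩ - T (A ξ) = S (ξ : H)

/-- `T` is in the domain of `δᵏ`, and `δᵏ(T) = S`, where `δ(T) = [|D|, T]`. -/
def IsDelta : ℕ → (H →L[ℂ] H) → (H →L[ℂ] H) → Prop
  | 0, T, S => S = T
  | k + 1, T, S => ∃ R, IsDelta k T R ∧ IsCommutator absDirac R S

/-- The algebra `ℬ` generated by the `δᵏ(a)` and `δᵏ([D, a])`, for `a ∈ 𝒜` and `k ≥ 0`. -/
def algB : Subalgebra ℂ (H →L[ℂ] H) :=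
  Algebra.adjoin ℂ {T | ∃ a ∈ smoothAlg, ∃ k : ℕ,
    IsDelta k a T ∨ ∃ da, IsCommutator dirac a da ∧ IsDelta k da T}

/-! ### Traces and zeta functions -/

/-- The absolute value `|T| = (T* T)^{1/2}` of a bounded operator on a Hilbert space. -/
def absOp {E : Type*} [NormedAddCommGroup E] [InnerProductSpace ℂ E] [CompleteSpace E]
    (T : E →L[ℂ] E) : E →L[ℂ] E := CFC.abs T

/-- `T` is of trace class: the positive operator `|T| = (T* T)^{1/2}` has finite trace. -/
def IsTraceClass (T : H →L[ℂ] H) : Prop :=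
  Summable fun i : Idx => ⟪e i, absOp T (e i)⟫_ℂ

/-- The trace of a trace class operator. -/
def opTrace (T : H →L[ℂ] H) : ℂ := ∑' i : Idx, ⟪e i, T (e i)⟫_ℂ

/-- The eigenvalues of `|D|`, the eigenvalue `0` being replaced by `ε`. -/
def absDiracEig (ε : ℝ) (t : Idx) : ℝ := if |diracEig t| = 0 then ε else |diracEig t|

/-- The operator `|D|^{-s}`, with `|D|` replaced by `ε > 0` on the kernel of `D`; it is bounded
for `Re s ≥ 0`, and only used there. -/
def absDiracNegPow (ε : ℝ) (s : ℂ) : H →L[ℂ] H :=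
  boundedDiag fun t => ((absDiracEig ε t : ℝ) : ℂ) ^ (-s)

theorem absDiracNegPow_apply {ε : ℝ} (hε : 0 < ε) {s : ℂ} (hs : 0 ≤ s.re) (ξ : H) (t : Idx) :
    absDiracNegPow ε s ξ t = ((absDiracEig ε t : ℝ) : ℂ) ^ (-s) * ξ t := by
  refine boundedDiag_apply ⟨max 1 (ε ^ (-s.re)), fun i => ?_⟩ ξ t
  have habs : |diracEig i| = i.N := by
    unfold diracEig; split_ifs <;> simp
  unfold absDiracEig
  rw [habs]
  split_ifs with h
  · rw [Complex.norm_cpow_eq_rpow_re_of_pos hε]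
    exact le_max_right _ _
  · have h0 : i.N ≠ 0 := by exact_mod_cast h
    have h1 : (1 : ℝ) ≤ i.N := by exact_mod_cast Nat.one_le_iff_ne_zero.mpr h0
    rw [Complex.norm_cpow_eq_rpow_re_of_pos (by linarith)]
    refine le_trans ?_ (le_max_left _ _)
    exact Real.rpow_le_one_of_one_le_of_nonpos h1 (by simpa using hs)

/-- `ζ_b(s) = Trace (b |D|^{-s})`, for `Re s > 3`. -/
def zetaFun (ε : ℝ) (b : H →L[ℂ] H) (s : ℂ) : ℂ := opTrace (b * absDiracNegPow ε s)

/-- Given a family `𝓕` of functions on the half plane `Re s > p`, the closed discrete set `S` is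
the set of their singularities, and all of these are simple poles: each member of `𝓕` extends to
a holomorphic function on `ℂ \ S` with at most simple poles at the points of `S`, and at each
point of `S` some member of `𝓕` is actually singular. -/
structure IsSimpleDimensionSpectrum (p : ℝ) (𝓕 : Set (ℂ → ℂ)) (S : Set ℂ) : Prop where
  isClosed : IsClosed S
  isDiscrete : IsDiscrete S
  extension : ∀ ζ ∈ 𝓕, ∃ Z : ℂ → ℂ, Meromorphic Z ∧ AnalyticOnNhd ℂ Z Sᶜ ∧
    (∀ z ∈ S, -1 ≤ meromorphicOrderAt Z z) ∧ ∀ s : ℂ, p < s.re → s ∉ S → Z s = ζ s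
  singular : ∀ z ∈ S, ∃ ζ ∈ 𝓕, ¬ ∃ Z : ℂ → ℂ, AnalyticOnNhd ℂ Z (insert z Sᶜ) ∧
    ∀ s : ℂ, p < s.re → s ∉ S → Z s = ζ s

end QuantumSU2

end

open QuantumSU2

/-!
Label the basis vectors by the lattice points `(2n, i + n, j + n)` of `ℤ³` and consider an operator
through its matrix coefficients, a function on pairs of lattice points. The operators of `𝒜`, the
commutators `[D, a]` and all their iterated commutators with `|D|` have coefficients which decay
rapidly away from the diagonal and whose difference under a simultaneous shift of both points along
a suitable basis of `ℤ³` decays rapidly in the corresponding coordinate. Such coefficient functions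
are stable under composition, so that they include those of all `b ∈ ℬ`.

For `Re s > 3` the trace of `b |D|^{-s}` is the Dirichlet series of the sums of the diagonal of `b`
over the eigenspaces of `|D|`. The labels of an eigenspace form two triangles. Rapid decay of the
differences of a function on `ℕ³` makes its sum over the triangle `x + y + z = n` a polynomial of
degree at most `2` in `n` up to a rapidly decaying error. The powers `n ^ 2`, `n` and `1` have the
Dirichlet series `ζ(s - 2)`, `ζ(s - 1)` and `ζ(s)`, and that of the error is entire. The
coefficients for `b = 1` are those of `(n + 1) ^ 2`, none of which vanishes.
-/

noncomputable section

namespace QuantumSU2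

/-! ### Families of rapid decay -/

/-- A family of vectors whose norms decay faster than every power of the weight `w`; on `ℕ` with
`w = id` this is `RapidDecay`. -/
def Rapid {X E : Type*} [SeminormedAddCommGroup E] (w : X → ℕ) (f : X → E) : Prop :=
  ∀ r : ℕ, ∃ C : ℝ, ∀ x, (1 + (w x : ℝ)) ^ r * ‖f x‖ ≤ C

namespace Rapid

variable {X Y E F : Type*} [SeminormedAddCommGroup E] [SeminormedAddCommGroup F]
  {w w' : X → ℕ} {f g : X → E}

theorem exists_norm_le_mul_inv (hf : Rapid w f) (r : ℕ) :
    ∃ C : ℝ, 0 ≤ C ∧ ∀ x, ‖f x‖ ≤ C * ((1 + (w x : ℝ)) ^ r)⁻¹ := by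
  obtain ⟨C, hC⟩ := hf r
  refine ⟨|C|, abs_nonneg _, fun x => ?_⟩
  have h0 : 0 < (1 + (w x : ℝ)) ^ r := by positivity
  rw [← div_eq_mul_inv, le_div_iff₀ h0, mul_comm]
  exact (hC x).trans (le_abs_self C)

theorem exists_norm_le (hf : Rapid w f) : ∃ C : ℝ, ∀ x, ‖f x‖ ≤ C :=
  (hf 0).imp fun C hC x => by simpa using hC x

theorem add (hf : Rapid w f) (hg : Rapid w g) : Rapid w (f + g) := by
  intro r
  obtain ⟨C, hC⟩ := hf r
  obtain ⟨C', hC'⟩ := hg r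
  refine ⟨C + C', fun x => ?_⟩
  calc (1 + (w x : ℝ)) ^ r * ‖(f + g) x‖
      ≤ (1 + (w x : ℝ)) ^ r * (‖f x‖ + ‖g x‖) := by gcongr; exact norm_add_le _ _
    _ ≤ C + C' := by rw [mul_add]; exact add_le_add (hC x) (hC' x)

theorem comp (hf : Rapid w f) (φ : Y → X) : Rapid (w ∘ φ) (f ∘ φ) := fun r =>
  (hf r).imp fun _ hC y => hC (φ y)

theorem of_le {g : X → F} (hf : Rapid w f) (A B : ℕ) (C : ℝ)
    (hw : ∀ x, g x ≠ 0 → 1 + w' x ≤ A * (1 + w x))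
    (hg : ∀ x, ‖g x‖ ≤ C * (1 + (w x : ℝ)) ^ B * ‖f x‖) : Rapid w' g := by
  intro r
  obtain ⟨K, hK⟩ := hf (r + B)
  refine ⟨A ^ r * |C| * |K|, fun x => ?_⟩
  by_cases h0 : g x = 0
  · simp only [h0, norm_zero, mul_zero]; positivity
  have h1 : (1 + (w' x : ℝ)) ≤ A * (1 + (w x : ℝ)) := by exact_mod_cast hw x h0
  calc (1 + (w' x : ℝ)) ^ r * ‖g x‖
      ≤ (A * (1 + (w x : ℝ))) ^ r * (|C| * (1 + (w x : ℝ)) ^ B * ‖f x‖) := by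
        gcongr
        exact (hg x).trans (by gcongr; exact le_abs_self C)
    _ = A ^ r * |C| * ((1 + (w x : ℝ)) ^ (r + B) * ‖f x‖) := by rw [mul_pow]; ring
    _ ≤ A ^ r * |C| * |K| := by gcongr; exact (hK x).trans (le_abs_self K)

theorem of_weight_le (hf : Rapid w f) (A : ℕ) (hw : ∀ x, f x ≠ 0 → 1 + w' x ≤ A * (1 + w x)) :
    Rapid w' f :=
  hf.of_le A 0 1 hw fun x => by simp

theorem of_norm_le {g : X → F} (hf : Rapid w f) (C : ℝ) (hg : ∀ x, ‖g x‖ ≤ C * ‖f x‖) :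
    Rapid w g :=
  hf.of_le 1 0 C (fun x _ => by omega) fun x => by simpa using hg x

theorem neg (hf : Rapid w f) : Rapid w (-f) :=
  hf.of_norm_le 1 fun x => by simp

theorem sub (hf : Rapid w f) (hg : Rapid w g) : Rapid w (f - g) := by
  rw [sub_eq_add_neg]; exact hf.add hg.neg

theorem const_smul {𝕜 : Type*} [NormedField 𝕜] [NormedSpace 𝕜 E] (hf : Rapid w f) (c : 𝕜) :
    Rapid w (c • f) :=
  hf.of_norm_le ‖c‖ fun x => (norm_smul c (f x)).le

theorem add_weight (hf : Rapid w f) (hf' : Rapid w' f) : Rapid (w + w') f := by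
  intro r
  obtain ⟨C, hC⟩ := hf r
  obtain ⟨C', hC'⟩ := hf' r
  refine ⟨2 ^ (r - 1) * (C + C'), fun x => ?_⟩
  calc (1 + ((w x + w' x : ℕ) : ℝ)) ^ r * ‖f x‖
      ≤ ((1 + (w x : ℝ)) + (1 + (w' x : ℝ))) ^ r * ‖f x‖ := by
        refine mul_le_mul_of_nonneg_right (pow_le_pow_left₀ (by positivity) ?_ r) (norm_nonneg _)
        push_cast
        linarith
    _ ≤ 2 ^ (r - 1) * ((1 + (w x : ℝ)) ^ r + (1 + (w' x : ℝ)) ^ r) * ‖f x‖ := by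
        gcongr
        exact add_pow_le (by positivity) (by positivity) r
    _ = 2 ^ (r - 1) * ((1 + (w x : ℝ)) ^ r * ‖f x‖ + (1 + (w' x : ℝ)) ^ r * ‖f x‖) := by ring
    _ ≤ 2 ^ (r - 1) * (C + C') := by gcongr; exacts [hC x, hC' x]

theorem sum_weight {ι : Type*} {w : ι → X → ℕ} {s : Finset ι} (h0 : Rapid 0 f)
    (h : ∀ i ∈ s, Rapid (w i) f) : Rapid (∑ i ∈ s, w i) f :=
  Finset.sum_induction w (Rapid · f) (fun _ _ => add_weight) h0 h

end Rapid

theorem summable_inv_one_add_sq : Summable fun n : ℕ => ((1 + (n : ℝ)) ^ 2)⁻¹ := by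
  simpa [add_comm] using (summable_nat_add_iff 1).2 (Real.summable_nat_pow_inv.2 one_lt_two)

theorem Rapid.summable_norm {E : Type*} [SeminormedAddCommGroup E] {f : ℕ → E}
    (hf : Rapid id f) : Summable fun n => ‖f n‖ := by
  obtain ⟨C, -, hC⟩ := hf.exists_norm_le_mul_inv 2
  exact (summable_inv_one_add_sq.mul_left C).of_nonneg_of_le (fun _ => norm_nonneg _) hC

/-! ### Backward differences -/

section BackwardDiff

variable {E : Type*}

/-- The backward difference of a sequence, continued by zero to the negative integers. -/
def backwardDiff [AddGroup E] (f : ℕ → E) : ℕ → E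
  | 0 => f 0
  | n + 1 => f (n + 1) - f n

theorem sum_backwardDiff [AddCommGroup E] (f : ℕ → E) (n : ℕ) :
    ∑ k ∈ Finset.range (n + 1), backwardDiff f k = f n := by
  simp only [Finset.sum_range_succ', backwardDiff, Finset.sum_range_sub, sub_add_cancel]

theorem backwardDiff_sub [AddCommGroup E] (f g : ℕ → E) :
    backwardDiff (f - g) = backwardDiff f - backwardDiff g := by
  ext (_ | n)
  · rfl
  · exact sub_sub_sub_comm _ _ _ _

theorem backwardDiff_const_mul (c : ℂ) (f : ℕ → ℂ) :
    backwardDiff (fun n => c * f n) = fun n => c * backwardDiff f n := by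
  ext (_ | n)
  · rfl
  · exact (mul_sub _ _ _).symm

theorem backwardDiff_choose (d : ℕ) :
    backwardDiff (fun n => ((n + (d + 1)).choose (d + 1) : ℂ))
      = fun n => ((n + d).choose d : ℂ) := by
  ext (_ | n)
  · simp [backwardDiff]
  · rw [backwardDiff, sub_eq_iff_eq_add, ← Nat.cast_add,
      show n + 1 + (d + 1) = n + d + 1 + 1 by ring, Nat.choose_succ_succ,
      show n + 1 + d = n + d + 1 by ring, show n + (d + 1) = n + d + 1 by ring]

theorem backwardDiff_iterate_sub [AddCommGroup E] (f g : ℕ → E) (d : ℕ) :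
    backwardDiff^[d] (f - g) = backwardDiff^[d] f - backwardDiff^[d] g := by
  induction d generalizing f g with
  | zero => rfl
  | succ d ih => simp only [Function.iterate_succ_apply, backwardDiff_sub, ih]

theorem backwardDiff_iterate_const_mul_choose (c : ℂ) (d : ℕ) :
    backwardDiff^[d] (fun n => c * ((n + d).choose d : ℂ)) = fun _ => c := by
  induction d with
  | zero => simp
  | succ d ih =>
    rw [Function.iterate_succ_apply, backwardDiff_const_mul, backwardDiff_choose, ih]

theorem Rapid.exists_sub_const_of_backwardDiff [NormedAddCommGroup E] [CompleteSpace E]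
    {f : ℕ → E} (hf : Rapid id (backwardDiff f)) : ∃ L : E, Rapid id (f - fun _ => L) := by
  have hs : Summable (backwardDiff f) := hf.summable_norm.of_norm
  refine ⟨∑' k, backwardDiff f k, fun r => ?_⟩
  obtain ⟨C, hC0, hC⟩ := hf.exists_norm_le_mul_inv (r + 2)
  refine ⟨C * ∑' k : ℕ, ((1 + (k : ℝ)) ^ 2)⁻¹, fun n => ?_⟩
  have tail : f n - ∑' k, backwardDiff f k = -∑' k, backwardDiff f (k + (n + 1)) := by
    rw [← hs.sum_add_tsum_nat_add (n + 1), sum_backwardDiff, sub_add_cancel_left]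
  have bound (k : ℕ) : ‖backwardDiff f (k + (n + 1))‖
      ≤ C * ((1 + (n : ℝ)) ^ r)⁻¹ * ((1 + (k : ℝ)) ^ 2)⁻¹ := by
    refine (hC _).trans ?_
    rw [pow_add, mul_inv, ← mul_assoc]
    simp only [id]
    gcongr <;> linarith
  simp only [Pi.sub_apply, tail, norm_neg, id]
  have := tsum_of_norm_bounded (summable_inv_one_add_sq.mul_left _).hasSum bound
  rw [tsum_mul_left] at this
  calc (1 + (n : ℝ)) ^ r * ‖∑' k, backwardDiff f (k + (n + 1))‖
      ≤ (1 + (n : ℝ)) ^ r * (C * ((1 + (n : ℝ)) ^ r)⁻¹ * ∑' k : ℕ, ((1 + (k : ℝ)) ^ 2)⁻¹) := by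
        gcongr
    _ = C * ∑' k : ℕ, ((1 + (k : ℝ)) ^ 2)⁻¹ := by field_simp

theorem Rapid.exists_sub_sum_choose_of_backwardDiff {d : ℕ} {f : ℕ → ℂ}
    (hf : Rapid id (backwardDiff^[d] f)) :
    ∃ c : ℕ → ℂ, Rapid id (f - fun n => ∑ j ∈ Finset.range d, c j * ((n + j).choose j : ℂ)) := by
  induction d generalizing f with
  | zero => exact ⟨0, by convert hf using 1; ext n; simp⟩
  | succ d ih =>
    rw [Function.iterate_succ_apply'] at hf
    obtain ⟨L, hL⟩ := hf.exists_sub_const_of_backwardDiff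
    rw [← backwardDiff_iterate_const_mul_choose L d, ← backwardDiff_iterate_sub] at hL
    obtain ⟨c, hc⟩ := ih hL
    refine ⟨Function.update c d L, ?_⟩
    convert hc using 1
    ext n
    simp only [Pi.sub_apply, Finset.sum_range_succ, Function.update_self]
    rw [Finset.sum_congr rfl fun j hj => by
      rw [Function.update_of_ne (Finset.mem_range.1 hj).ne]]
    ring

end BackwardDiff

/-! ### Sums over discrete simplices -/

section Simplex

variable {ι : Type*} [DecidableEq ι] {E : Type*}

theorem tsub_single_add_single {a : ι → ℕ} {i : ι} (ha : a i ≠ 0) :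
    a - Pi.single i 1 + Pi.single i 1 = a := by
  ext j
  simp only [Pi.add_apply, Pi.sub_apply, Pi.single_apply]
  split_ifs with h
  · subst h; omega
  · rfl

/-- The backward difference in the direction `i` of a function of several natural numbers,
continued by zero. -/
def backwardDiffAt [AddGroup E] (i : ι) (g : (ι → ℕ) → E) (a : ι → ℕ) : E :=
  g a - if a i = 0 then 0 else g (a - Pi.single i 1)

theorem backwardDiffAt_comm [AddCommGroup E] (i j : ι) (g : (ι → ℕ) → E) :
    backwardDiffAt i (backwardDiffAt j g) = backwardDiffAt j (backwardDiffAt i g) := by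
  obtain rfl | hij := eq_or_ne i j
  · rfl
  ext a
  simp only [backwardDiffAt, Pi.sub_apply, Pi.single_eq_of_ne hij, Pi.single_eq_of_ne hij.symm,
    tsub_zero, tsub_right_comm (b := Pi.single i 1)]
  split_ifs <;> abel

theorem rapid_backwardDiffAt [SeminormedAddCommGroup E] {w : (ι → ℕ) → ℕ} {g : (ι → ℕ) → E} (j : ι)
    (hw : ∀ a, w a ≤ w (a - Pi.single j 1) + 1) (hg : Rapid w g) :
    Rapid w (backwardDiffAt j g) := by
  refine hg.sub ?_
  refine (hg.comp fun a : ι → ℕ => a - Pi.single j 1).of_le 2 0 1 (fun a _ => ?_) fun a => ?_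
  · have := hw a
    simp only [Function.comp_apply]
    omega
  · split_ifs <;> simp

theorem apply_le_sub_single_add_one (i j : ι) (a : ι → ℕ) :
    a i ≤ (a - Pi.single j 1 : ι → ℕ) i + 1 := by
  simp only [Pi.sub_apply, Pi.single_apply]
  split_ifs <;> omega

theorem rapid_backwardDiffAt_self [SeminormedAddCommGroup E] {g : (ι → ℕ) → E} (h0 : Rapid 0 g)
    {i : ι} (h : Rapid (fun a => a i) fun a => g (a + Pi.single i 1) - g a) :
    Rapid (fun a => a i) (backwardDiffAt i g) := by
  have boundary : Rapid (fun a => a i) fun a : ι → ℕ => if a i = 0 then g a else 0 :=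
    h0.of_le 1 0 1 (fun a ha => by simp_all) fun a => by split_ifs <;> simp
  have interior : Rapid (fun a => a i) fun a : ι → ℕ =>
      if a i = 0 then 0 else g a - g (a - Pi.single i 1) := by
    refine (h.comp fun a : ι → ℕ => a - Pi.single i 1).of_le 2 0 1 (fun a _ => ?_) fun a => ?_
    · simp only [Function.comp_apply, Pi.sub_apply, Pi.single_eq_same]
      omega
    · split_ifs with ha
      · simp
      · simp [tsub_single_add_single ha]
  convert boundary.add interior using 1
  ext a
  simp only [backwardDiffAt, Pi.add_apply]
  split_ifs <;> simp

theorem rapid_foldr_backwardDiffAt [SeminormedAddCommGroup E] {g : (ι → ℕ) → E} (l : List ι)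
    (h : ∀ i, Rapid (fun a => a i) (backwardDiffAt i g)) :
    ∀ i ∈ l, Rapid (fun a => a i) (l.foldr backwardDiffAt g) := by
  have decay_next (l : List ι) (i : ι) :
      Rapid (fun a => a i) (backwardDiffAt i (l.foldr backwardDiffAt g)) := by
    induction l with
    | nil => exact h i
    | cons j l ih =>
      rw [List.foldr_cons, backwardDiffAt_comm]
      exact rapid_backwardDiffAt j (apply_le_sub_single_add_one i j) ih
  induction l with
  | nil => simp
  | cons j l ih =>
    intro i hi
    obtain rfl | hi := List.mem_cons.1 hi
    · exact decay_next l i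
    · exact rapid_backwardDiffAt j (apply_le_sub_single_add_one i j) (ih i hi)

variable [Fintype ι]

/-- The sum of `g` over the points of the discrete simplex `{a : ∑ i, a i = n}`. -/
def simplexSum [AddCommMonoid E] (g : (ι → ℕ) → E) (n : ℕ) : E :=
  ∑ a ∈ Finset.univ.piAntidiag n, g a

theorem simplexSum_backwardDiffAt [AddCommGroup E] (i : ι) (g : (ι → ℕ) → E) :
    simplexSum (backwardDiffAt i g) = backwardDiff (simplexSum g) := by
  ext (_ | n)
  · simp [simplexSum, backwardDiff, backwardDiffAt]
  simp only [simplexSum, backwardDiff, backwardDiffAt, Finset.sum_sub_distrib]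
  congr 1
  rw [Finset.sum_ite, Finset.sum_const_zero, zero_add]
  refine Finset.sum_nbij' (· - Pi.single i 1) (· + Pi.single i 1) (fun a ha => ?_) (fun a ha => ?_)
    (fun a ha => tsub_single_add_single (Finset.mem_filter.1 ha).2)
    (fun a _ => add_tsub_cancel_right _ _) (fun _ _ => rfl)
  · obtain ⟨hsum, hi⟩ := Finset.mem_filter.1 ha
    have := congrArg (fun b : ι → ℕ => ∑ j, b j) (tsub_single_add_single hi)
    simp_all [Finset.mem_piAntidiag, Finset.sum_add_distrib]
  · simp_all [Finset.mem_piAntidiag, Finset.sum_add_distrib]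

theorem simplexSum_foldr_backwardDiffAt [AddCommGroup E] (l : List ι) (g : (ι → ℕ) → E) :
    simplexSum (l.foldr backwardDiffAt g) = backwardDiff^[l.length] (simplexSum g) := by
  induction l with
  | nil => rfl
  | cons i l ih =>
    rw [List.foldr_cons, simplexSum_backwardDiffAt, ih, List.length_cons,
      Function.iterate_succ_apply']

theorem card_piAntidiag_univ_le (n : ℕ) :
    ((Finset.univ : Finset ι).piAntidiag n).card ≤ (n + 1) ^ Fintype.card ι := by
  have : (Finset.univ : Finset ι).piAntidiag n
      ⊆ Fintype.piFinset fun _ => Finset.range (n + 1) := fun a ha => by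
    obtain ⟨hsum, -⟩ := Finset.mem_piAntidiag.1 ha
    refine Fintype.mem_piFinset.2 fun i => Finset.mem_range.2 (Nat.lt_succ_of_le ?_)
    exact hsum ▸ Finset.single_le_sum (fun _ _ => Nat.zero_le _) (Finset.mem_univ i)
  simpa using Finset.card_le_card this

theorem Rapid.simplexSum [SeminormedAddCommGroup E] {g : (ι → ℕ) → E}
    (hg : Rapid (fun a => ∑ i, a i) g) : Rapid id (simplexSum g) := by
  intro r
  obtain ⟨C, hC0, hC⟩ := hg.exists_norm_le_mul_inv (r + Fintype.card ι)
  refine ⟨C, fun n => ?_⟩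
  have bound (a) (ha : a ∈ Finset.univ.piAntidiag n) :
      ‖g a‖ ≤ C * ((1 + (n : ℝ)) ^ (r + Fintype.card ι))⁻¹ := by
    simpa only [(Finset.mem_piAntidiag.1 ha).1] using hC a
  calc (1 + (n : ℝ)) ^ r * ‖QuantumSU2.simplexSum g n‖
      ≤ (1 + (n : ℝ)) ^ r * ∑ _a ∈ (Finset.univ : Finset ι).piAntidiag n,
          C * ((1 + (n : ℝ)) ^ (r + Fintype.card ι))⁻¹ := by
        gcongr
        exact norm_sum_le_of_le _ bound
    _ ≤ (1 + (n : ℝ)) ^ r * ((1 + (n : ℝ)) ^ Fintype.card ι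
        * (C * ((1 + (n : ℝ)) ^ (r + Fintype.card ι))⁻¹)) := by
        rw [Finset.sum_const, nsmul_eq_mul, add_comm 1 (n : ℝ)]
        gcongr
        exact_mod_cast card_piAntidiag_univ_le n
    _ = C := by rw [pow_add]; field_simp

/-- Each difference operator makes `g` decay in its own direction, and summation over simplices
turns every one of them into the difference operator on `ℕ`. -/
theorem exists_rapid_simplexSum_sub_sum_choose {g : (ι → ℕ) → ℂ} (h0 : Rapid 0 g)
    (h : ∀ i, Rapid (fun a => a i) fun a => g (a + Pi.single i 1) - g a) :
    ∃ c : ℕ → ℂ, Rapid id (simplexSum g - fun n =>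
      ∑ j ∈ Finset.range (Fintype.card ι), c j * ((n + j).choose j : ℂ)) := by
  refine Rapid.exists_sub_sum_choose_of_backwardDiff ?_
  have bounded (l : List ι) : Rapid 0 (l.foldr backwardDiffAt g) := by
    induction l with
    | nil => exact h0
    | cons i l ih => exact rapid_backwardDiffAt i (fun _ => Nat.zero_le _) ih
  have decay := Rapid.sum_weight (s := Finset.univ) (bounded Finset.univ.toList) fun i _ =>
    rapid_foldr_backwardDiffAt _ (fun i => rapid_backwardDiffAt_self h0 (h i)) i (by simp)
  rw [Finset.sum_fn] at decay
  simpa only [simplexSum_foldr_backwardDiffAt, Finset.length_toList,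
    Finset.card_univ] using decay.simplexSum

end Simplex

/-! ### Kernels on a lattice -/

section Shift

variable {ι : Type*} [DecidableEq ι]

/-- The diagonal translation by the `i`-th unit vector. -/
def shift (i : ι) (z : (ι → ℤ) × (ι → ℤ)) : (ι → ℤ) × (ι → ℤ) :=
  (z.1 + Pi.single i 1, z.2 + Pi.single i 1)

/-- The increment of a kernel under diagonal translation. -/
def shiftDiff (i : ι) (K : (ι → ℤ) × (ι → ℤ) → ℂ) (z : (ι → ℤ) × (ι → ℤ)) : ℂ :=
  K (shift i z) - K z

theorem shiftDiff_mul (i : ι) (m K : (ι → ℤ) × (ι → ℤ) → ℂ) :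
    shiftDiff i (m * K) = m ∘ shift i * shiftDiff i K + shiftDiff i m * K := by
  ext z
  simp only [shiftDiff, Pi.add_apply, Pi.mul_apply, Function.comp_apply]
  ring

end Shift

section Lattice

variable {ι : Type*} [Fintype ι]

/-- The `ℓ¹` distance of two lattice points, that is, the distance of an entry of a matrix from
the diagonal. -/
def offDiag (z : (ι → ℤ) × (ι → ℤ)) : ℕ := ∑ i, (z.1 i - z.2 i).natAbs

theorem natAbs_sub_le_offDiag (i : ι) (z : (ι → ℤ) × (ι → ℤ)) :
    (z.1 i - z.2 i).natAbs ≤ offDiag z :=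
  Finset.single_le_sum (f := fun i => (z.1 i - z.2 i).natAbs) (fun _ _ => Nat.zero_le _)
    (Finset.mem_univ i)

theorem offDiag_triangle (p s q : ι → ℤ) : offDiag (p, q) ≤ offDiag (p, s) + offDiag (s, q) := by
  simp only [offDiag, ← Finset.sum_add_distrib]
  exact Finset.sum_le_sum fun i _ => by omega

theorem summable_prod_apply {κ : Type*} {f : κ → ℝ} (hf : Summable f)
    (h0 : ∀ k, 0 ≤ f k) : Summable fun p : ι → κ => ∏ i, f (p i) := by
  classical
  refine summable_of_sum_le (c := ∏ _i : ι, ∑' k, f k) (fun p => Finset.prod_nonneg fun i _ => h0 _)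
    fun s => ?_
  have subset_piFinset : s ⊆ Fintype.piFinset fun i => s.image (· i) := fun p hp =>
    Fintype.mem_piFinset.2 fun i => Finset.mem_image_of_mem _ hp
  calc ∑ p ∈ s, ∏ i, f (p i)
      ≤ ∑ p ∈ Fintype.piFinset fun i => s.image (· i), ∏ i, f (p i) :=
        Finset.sum_le_sum_of_subset_of_nonneg subset_piFinset fun p _ _ =>
          Finset.prod_nonneg fun i _ => h0 _
    _ = ∏ i, ∑ k ∈ s.image (· i), f k := (Finset.prod_univ_sum _ _).symm
    _ ≤ ∏ _i : ι, ∑' k, f k :=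
        Finset.prod_le_prod (fun i _ => Finset.sum_nonneg fun k _ => h0 k)
          fun i _ => hf.sum_le_tsum _ fun k _ => h0 k

theorem summable_int_inv_one_add_sq : Summable fun n : ℤ => ((1 + (n.natAbs : ℝ)) ^ 2)⁻¹ :=
  Summable.of_nat_of_neg (by simpa using summable_inv_one_add_sq)
    (by simpa using summable_inv_one_add_sq)

theorem summable_inv_offDiag_pow (q : ι → ℤ) :
    Summable fun s => ((1 + (offDiag (s, q) : ℝ)) ^ (2 * Fintype.card ι))⁻¹ := by
  have := (Equiv.subRight q).summable_iff.2
    (summable_prod_apply summable_int_inv_one_add_sq fun n => by positivity)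
  refine this.of_nonneg_of_le (fun _ => by positivity) fun s => ?_
  simp only [Function.comp_apply, Finset.prod_inv_distrib]
  gcongr ?_⁻¹
  rw [pow_mul, ← Finset.card_univ, ← Finset.prod_const]
  refine Finset.prod_le_prod (fun i _ => by positivity) fun i _ => ?_
  gcongr
  exact natAbs_sub_le_offDiag i (s, q)

theorem tsum_inv_offDiag_pow (q : ι → ℤ) :
    ∑' s, ((1 + (offDiag (s, q) : ℝ)) ^ (2 * Fintype.card ι))⁻¹
      = ∑' s : ι → ℤ, ((1 + (offDiag (s, 0) : ℝ)) ^ (2 * Fintype.card ι))⁻¹ := by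
  rw [← (Equiv.subRight q).tsum_eq
    fun s : ι → ℤ => ((1 + (offDiag (s, 0) : ℝ)) ^ (2 * Fintype.card ι))⁻¹]
  simp [offDiag]

/-- The product of two kernels, as infinite matrices. -/
def convKer (K L : (ι → ℤ) × (ι → ℤ) → ℂ) (z : (ι → ℤ) × (ι → ℤ)) : ℂ :=
  ∑' s, K (z.1, s) * L (s, z.2)

theorem summable_convKer {K L : (ι → ℤ) × (ι → ℤ) → ℂ} (hK : Rapid offDiag K)
    (hL : Rapid offDiag L) (z : (ι → ℤ) × (ι → ℤ)) :
    Summable fun s => K (z.1, s) * L (s, z.2) := by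
  obtain ⟨C, hC⟩ := hK.exists_norm_le
  obtain ⟨C', -, hC'⟩ := hL.exists_norm_le_mul_inv (2 * Fintype.card ι)
  refine .of_norm_bounded (((summable_inv_offDiag_pow z.2).mul_left C').mul_left C) fun s => ?_
  rw [norm_mul]
  exact mul_le_mul (hC _) (hC' _) (norm_nonneg _) ((norm_nonneg _).trans (hC (z.1, s)))

theorem norm_mul_le_of_weight_le {K L : (ι → ℤ) × (ι → ℤ) → ℂ}
    {w w' w'' : (ι → ℤ) × (ι → ℤ) → ℕ} (hK : Rapid w K) (hL : Rapid w' L)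
    (hw : ∀ p s q, w'' (p, q) ≤ 2 * (w (p, s) + w' (s, q))) (hw' : ∀ z, offDiag z ≤ w' z)
    (r B : ℕ) : ∃ C : ℝ, 0 ≤ C ∧ ∀ p s q, ‖K (p, s) * L (s, q)‖ ≤
      C * ((1 + (w'' (p, q) : ℝ)) ^ r)⁻¹ * ((1 + (offDiag (s, q) : ℝ)) ^ B)⁻¹ := by
  obtain ⟨C, hC0, hC⟩ := hK.exists_norm_le_mul_inv r
  obtain ⟨C', hC'0, hC'⟩ := hL.exists_norm_le_mul_inv (r + B)
  refine ⟨2 ^ r * C * C', by positivity, fun p s q => ?_⟩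
  have weights : (1 + (w'' (p, q) : ℝ)) ≤ 2 * ((1 + (w (p, s) : ℝ)) * (1 + (w' (s, q) : ℝ))) := by
    norm_cast
    nlinarith [hw p s q, Nat.zero_le (w (p, s) * w' (s, q))]
  have hinv : ((1 + (w (p, s) : ℝ)) ^ r)⁻¹ * ((1 + (w' (s, q) : ℝ)) ^ r)⁻¹
      ≤ 2 ^ r * ((1 + (w'' (p, q) : ℝ)) ^ r)⁻¹ := by
    rw [← mul_inv, ← mul_pow, ← div_eq_mul_inv, le_div_iff₀ (by positivity),
      inv_mul_le_iff₀ (by positivity), ← mul_pow, mul_comm _ (2 : ℝ)]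
    gcongr
  calc ‖K (p, s) * L (s, q)‖
      ≤ C * ((1 + (w (p, s) : ℝ)) ^ r)⁻¹ * (C' * ((1 + (w' (s, q) : ℝ)) ^ (r + B))⁻¹) := by
        rw [norm_mul]
        gcongr
        exacts [hC _, hC' _]
    _ = C * C' * (((1 + (w (p, s) : ℝ)) ^ r)⁻¹ * ((1 + (w' (s, q) : ℝ)) ^ r)⁻¹)
        * ((1 + (w' (s, q) : ℝ)) ^ B)⁻¹ := by rw [pow_add, mul_inv]; ring
    _ ≤ C * C' * (2 ^ r * ((1 + (w'' (p, q) : ℝ)) ^ r)⁻¹)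
        * ((1 + (offDiag (s, q) : ℝ)) ^ B)⁻¹ := by
        gcongr
        exact hw' _
    _ = 2 ^ r * C * C' * ((1 + (w'' (p, q) : ℝ)) ^ r)⁻¹
        * ((1 + (offDiag (s, q) : ℝ)) ^ B)⁻¹ := by ring

theorem Rapid.convKer {K L : (ι → ℤ) × (ι → ℤ) → ℂ} {w w' w'' : (ι → ℤ) × (ι → ℤ) → ℕ}
    (hK : Rapid w K) (hL : Rapid w' L) (hw : ∀ p s q, w'' (p, q) ≤ 2 * (w (p, s) + w' (s, q)))
    (hw' : ∀ z, offDiag z ≤ w' z) : Rapid w'' (convKer K L) := by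
  intro r
  obtain ⟨C, -, hC⟩ := norm_mul_le_of_weight_le hK hL hw hw' r (2 * Fintype.card ι)
  refine ⟨C * ∑' s : ι → ℤ, ((1 + (offDiag (s, 0) : ℝ)) ^ (2 * Fintype.card ι))⁻¹,
    fun ⟨p, q⟩ => ?_⟩
  have := tsum_of_norm_bounded ((summable_inv_offDiag_pow q).mul_left _).hasSum (hC p · q)
  rw [tsum_mul_left, tsum_inv_offDiag_pow, mul_right_comm, ← div_eq_mul_inv,
    le_div_iff₀' (by positivity)] at this
  exact this

variable [DecidableEq ι]

/-- The distance from the diagonal plus the modulus of the `i`-th coordinate. -/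
def dirWeight (i : ι) (z : (ι → ℤ) × (ι → ℤ)) : ℕ := offDiag z + (z.1 i).natAbs

theorem offDiag_shift (i : ι) (z : (ι → ℤ) × (ι → ℤ)) : offDiag (shift i z) = offDiag z := by
  simp [offDiag, shift]

theorem Rapid.shift {K : (ι → ℤ) × (ι → ℤ) → ℂ} (hK : Rapid offDiag K) (i : ι) :
    Rapid offDiag (K ∘ shift i) := by
  simpa only [Function.comp_def, offDiag_shift] using hK.comp (QuantumSU2.shift i)

theorem Rapid.shiftDiff {K : (ι → ℤ) × (ι → ℤ) → ℂ} (hK : Rapid offDiag K) (i : ι) :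
    Rapid offDiag (shiftDiff i K) :=
  (hK.shift i).sub hK

theorem shiftDiff_convKer {K L : (ι → ℤ) × (ι → ℤ) → ℂ} (hK : Rapid offDiag K)
    (hL : Rapid offDiag L) (i : ι) : shiftDiff i (convKer K L)
      = convKer (shiftDiff i K) (L ∘ shift i) + convKer K (shiftDiff i L) := by
  ext z
  have translate : convKer K L (shift i z)
      = ∑' s, (K ∘ shift i) (z.1, s) * (L ∘ shift i) (s, z.2) := by
    rw [convKer, ← (Equiv.addRight (Pi.single i 1 : ι → ℤ)).tsum_eq]
    rfl
  rw [shiftDiff, translate, Pi.add_apply, convKer, convKer, convKer,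
    ← (summable_convKer (hK.shift i) (hL.shift i) z).tsum_sub (summable_convKer hK hL z),
    ← (summable_convKer (hK.shiftDiff i) (hL.shift i) z).tsum_add
      (summable_convKer hK (hL.shiftDiff i) z)]
  refine tsum_congr fun s => ?_
  simp only [shiftDiff, Function.comp]
  ring

/-- Kernels of rapid decay off the diagonal, which are asymptotically invariant under translation
in each of the coordinate directions: the matrices of the operators that behave like elements
of `ℬ`. -/
structure SmoothKernel (K : (ι → ℤ) × (ι → ℤ) → ℂ) : Prop where
  rapid : Rapid offDiag K
  diff : ∀ i, Rapid (dirWeight i) (shiftDiff i K)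

namespace SmoothKernel

variable {K L : (ι → ℤ) × (ι → ℤ) → ℂ}

theorem of_support (hK : Rapid offDiag K)
    (h : ∀ i z, shiftDiff i K z ≠ 0 → (z.1 i).natAbs ≤ offDiag z + 1) : SmoothKernel K where
  rapid := hK
  diff i := (hK.shiftDiff i).of_weight_le 2 fun z hz => by
    have := h i z hz
    simp only [dirWeight]; omega

theorem of_rapid (h : Rapid (fun z => offDiag z + ∑ i, (z.1 i).natAbs) K) : SmoothKernel K where
  rapid := h.of_weight_le 1 fun z _ => by omega
  diff i := by
    have single_le (p : ι → ℤ) : (p i).natAbs ≤ ∑ i, (p i).natAbs :=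
      Finset.single_le_sum (f := fun i => (p i).natAbs) (fun _ _ => Nat.zero_le _)
        (Finset.mem_univ i)
    refine Rapid.sub ((h.comp (shift i)).of_weight_le 2 fun z _ => ?_)
      (h.of_weight_le 1 fun z _ => ?_)
    · have h1 := single_le (shift i z).1
      have h2 : (shift i z).1 i = z.1 i + 1 := by simp [shift]
      simp only [Function.comp_apply, offDiag_shift, dirWeight]
      omega
    · have := single_le z.1
      simp only [dirWeight]
      omega

theorem add (hK : SmoothKernel K) (hL : SmoothKernel L) : SmoothKernel (K + L) where
  rapid := hK.rapid.add hL.rapid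
  diff i := by
    convert (hK.diff i).add (hL.diff i) using 1
    ext z
    exact add_sub_add_comm _ _ _ _

theorem const_smul (hK : SmoothKernel K) (c : ℂ) : SmoothKernel (c • K) where
  rapid := hK.rapid.const_smul c
  diff i := by
    convert (hK.diff i).const_smul c using 1
    ext z
    exact (smul_sub c _ _).symm

theorem conv (hK : SmoothKernel K) (hL : SmoothKernel L) : SmoothKernel (convKer K L) where
  rapid := hK.rapid.convKer hL.rapid
    (fun p s q => (offDiag_triangle p s q).trans (by omega)) fun z => le_rfl
  diff i := by
    rw [shiftDiff_convKer hK.rapid hL.rapid]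
    refine Rapid.add ?_ ?_
    · refine (hK.diff i).convKer (hL.rapid.shift i) (fun p s q => ?_) fun z => le_rfl
      have := offDiag_triangle p s q
      simp only [dirWeight]; omega
    · refine hK.rapid.convKer (hL.diff i) (fun p s q => ?_) fun z => Nat.le_add_right _ _
      have := offDiag_triangle p s q
      have := natAbs_sub_le_offDiag i (p, s)
      simp only [dirWeight] at this ⊢; omega

theorem mul {m : (ι → ℤ) × (ι → ℤ) → ℂ} (hK : SmoothKernel K) (A : ℕ)
    (hm : ∀ z, ‖m z‖ ≤ A * (1 + offDiag z))
    (hd : ∀ i z, shiftDiff i m z ≠ 0 → (z.1 i).natAbs ≤ A * (1 + offDiag z)) :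
    SmoothKernel (m * K) where
  rapid := hK.rapid.of_le 1 1 A (fun z _ => by omega) fun z => by
    rw [Pi.mul_apply, norm_mul, pow_one]
    gcongr
    exact hm z
  diff i := by
    have hm_shift (z) : ‖m (shift i z)‖ ≤ A * (1 + offDiag z) := by
      simpa only [offDiag_shift] using hm (shift i z)
    rw [shiftDiff_mul]
    refine Rapid.add ?_ ?_
    · refine (hK.diff i).of_le 1 1 A (fun z _ => by omega) fun z => ?_
      rw [Pi.mul_apply, Function.comp_apply, norm_mul, pow_one]
      gcongr
      refine (hm_shift z).trans ?_
      gcongr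
      exact Nat.le_add_right _ _
    · refine hK.rapid.of_le (A + 1) 1 (2 * A) (fun z hz => ?_) fun z => ?_
      · have := hd i z (left_ne_zero_of_mul hz)
        simp only [dirWeight]
        linarith
      · rw [Pi.mul_apply, norm_mul, pow_one]
        gcongr
        calc ‖m (shift i z) - m z‖ ≤ ‖m (shift i z)‖ + ‖m z‖ := norm_sub_le _ _
          _ ≤ A * (1 + offDiag z) + A * (1 + offDiag z) := add_le_add (hm_shift z) (hm z)
          _ = 2 * A * (1 + offDiag z) := by ring

end SmoothKernel

end Lattice

/-- The lattice `ℤ³`; the label `(N, x, y)` corresponds to the point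
`(min x y, x - y, N - max x y)`. -/
abbrev Pt : Type := Fin 3 → ℤ

/-- The extension of the length function `(k, m, c) ↦ k + |m| + c` to the lattice. At the point
of a label `(N, x, y)` it takes the value `N`. -/
def ptLength (p : Pt) : ℤ := p 0 + (p 1).natAbs + p 2

theorem natAbs_ptLength_sub_le (z : Pt × Pt) :
    (ptLength z.1 - ptLength z.2).natAbs ≤ offDiag z := by
  simp only [ptLength, offDiag, Fin.sum_univ_three]
  omega

/-- The function by which a kernel is multiplied when one takes the commutator with the diagonal
operator whose eigenvalues are `w`. -/
def diffMultiplier (w : Pt → ℤ) (z : Pt × Pt) : ℂ := ((w z.1 - w z.2 : ℤ) : ℂ)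

theorem norm_diffMultiplier_ptLength_le (z : Pt × Pt) :
    ‖diffMultiplier ptLength z‖ ≤ 1 + offDiag z := by
  have : ((ptLength z.1 - ptLength z.2).natAbs : ℝ) ≤ offDiag z :=
    mod_cast natAbs_ptLength_sub_le z
  rw [diffMultiplier, Complex.norm_intCast, ← Int.cast_abs, Int.abs_eq_natAbs, Int.cast_natCast]
  linarith

theorem natAbs_le_of_shiftDiff_diffMultiplier_ptLength_ne_zero (i : Fin 3) (z : Pt × Pt)
    (h : shiftDiff i (diffMultiplier ptLength) z ≠ 0) : (z.1 i).natAbs ≤ 1 + offDiag z := by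
  have h' := mt (congrArg (Int.cast (R := ℂ))) (sub_ne_zero.1 h)
  have := natAbs_sub_le_offDiag i z
  obtain rfl | rfl | rfl : i = 0 ∨ i = 1 ∨ i = 2 := by omega
  all_goals
    simp only [ptLength, shift, Pi.add_apply, Pi.single_apply, Fin.reduceEq, if_true,
      if_false] at h'
    omega

theorem SmoothKernel.diffMultiplier_ptLength_mul {K : Pt × Pt → ℂ} (hK : SmoothKernel K) :
    SmoothKernel (diffMultiplier ptLength * K) :=
  hK.mul 1 (by simpa using norm_diffMultiplier_ptLength_le)
    (by simpa using natAbs_le_of_shiftDiff_diffMultiplier_ptLength_ne_zero)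

/-! ### Operators and their kernels -/

theorem inner_e (i : Idx) (ξ : H) : ⟪e i, ξ⟫_ℂ = ξ i := by
  classical
  rw [e, lp.inner_single_left, RCLike.inner_apply, map_one, mul_one]

theorem hasSum_e (ξ : H) : HasSum (fun i => ξ i • e i) ξ := by
  classical
  convert lp.hasSum_single (p := 2) (by norm_num) ξ using 2 with i
  rw [e, ← lp.single_smul, smul_eq_mul, mul_one]

theorem hasSum_coeff (T : H →L[ℂ] H) (ξ : H) (i : Idx) :
    HasSum (fun j => T (e j) i * ξ j) (T ξ i) := by
  have hasSum_inner := ((hasSum_e ξ).mapL T).mapL (innerSL ℂ (e i))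
  simpa only [map_smul, innerSL_apply_apply, inner_e, smul_eq_mul, mul_comm] using hasSum_inner

theorem mem_diagOp_domain {w : Idx → ℂ} {ξ : H} :
    ξ ∈ (diagOp w).domain ↔ Memℓp (fun i => w i * ξ i) 2 := Iff.rfl

theorem diagOp_apply (w : Idx → ℂ) (ξ : (diagOp w).domain) (i : Idx) :
    diagOp w ξ i = w i * (ξ : H) i := rfl

theorem mul_e_apply (w : Idx → ℂ) (i j : Idx) : w i * e j i = (w j • e j) i := by
  rw [lp.coeFn_smul, Pi.smul_apply, smul_eq_mul, e_apply]
  split_ifs with hij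
  · rw [hij]
  · rw [mul_zero, mul_zero]

theorem e_mem_diagOp_domain (w : Idx → ℂ) (j : Idx) : e j ∈ (diagOp w).domain := by
  simp only [mem_diagOp_domain, mul_e_apply]
  exact lp.memℓp _

theorem diagOp_e (w : Idx → ℂ) (j : Idx) :
    diagOp w ⟨e j, e_mem_diagOp_domain w j⟩ = w j • e j :=
  H_ext fun i => (diagOp_apply w _ i).trans (mul_e_apply w i j)

theorem isCommutator_diagOp {w : Idx → ℂ} {T S : H →L[ℂ] H} :
    IsCommutator (diagOp w) T S ↔ ∀ i j, S (e j) i = (w i - w j) * T (e j) i := by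
  refine ⟨fun h i j => ?_, fun h ξ => ?_⟩
  · obtain ⟨_, hS⟩ := h ⟨e j, e_mem_diagOp_domain w j⟩
    rw [← hS, diagOp_e, map_smul, lp.coeFn_sub, Pi.sub_apply, diagOp_apply, lp.coeFn_smul,
      Pi.smul_apply, smul_eq_mul, sub_mul]
  · have diag_mul_apply (i : Idx) : w i * T (ξ : H) i = (S (ξ : H) + T (diagOp w ξ)) i := by
      have termwise (j : Idx) : S (e j) i * (ξ : H) j + T (e j) i * diagOp w ξ j
          = w i * (T (e j) i * (ξ : H) j) := by
        rw [h, diagOp_apply]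
        ring
      have hasSum_right := (hasSum_coeff S (ξ : H) i).add (hasSum_coeff T (diagOp w ξ) i)
      simp only [termwise] at hasSum_right
      exact ((hasSum_coeff T (ξ : H) i).mul_left (w i)).unique hasSum_right
    have mem_domain : T (ξ : H) ∈ (diagOp w).domain := by
      simp only [mem_diagOp_domain, diag_mul_apply]
      exact lp.memℓp _
    refine ⟨mem_domain, H_ext fun i => ?_⟩
    rw [lp.coeFn_sub, Pi.sub_apply, diagOp_apply, diag_mul_apply, lp.coeFn_add, Pi.add_apply,
      add_sub_cancel_right]

/-- The lattice point attached to the natural numbers `(N, x, y)`, meaningful for `x, y ≤ N`. In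
these coordinates `α` lowers the first one, and `β` moves the second one along `min x y = 0`. -/
def labelPt (N x y : ℕ) : Pt := ![min (x : ℤ) y, x - y, N - max (x : ℤ) y]

/-- The lattice point of a label. -/
def Idx.toPt (t : Idx) : Pt := labelPt t.N t.x t.y

/-- The lattice points which come from labels. -/
def IsLabel (p : Pt) : Prop := 0 ≤ p 0 ∧ 0 ≤ p 2

instance : DecidablePred IsLabel := fun p => inferInstanceAs (Decidable (0 ≤ p 0 ∧ 0 ≤ p 2))

/-- The label of a lattice point, inverse to `Idx.toPt`; it is meaningless unless `IsLabel p`. -/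
def ptIdx (p : Pt) : Idx :=
  ⟨(p 0).toNat + (p 1).natAbs + (p 2).toNat, (p 0).toNat + (p 1).toNat,
    (p 0).toNat + (-p 1).toNat, by omega, by omega⟩

theorem ptIdx_toPt (t : Idx) : ptIdx t.toPt = t := by
  obtain ⟨N, x, y, hx, hy⟩ := t
  simp only [ptIdx, Idx.toPt, labelPt, Matrix.cons_val, Idx.mk.injEq]
  omega

theorem toPt_ptIdx {p : Pt} (hp : IsLabel p) : (ptIdx p).toPt = p := by
  obtain ⟨h0, h2⟩ := hp
  ext i
  obtain rfl | rfl | rfl : i = 0 ∨ i = 1 ∨ i = 2 := by omega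
  all_goals
    simp only [ptIdx, Idx.toPt, labelPt, Matrix.cons_val]
    omega

theorem isLabel_toPt (t : Idx) : IsLabel t.toPt := by
  obtain ⟨N, x, y, hx, hy⟩ := t
  simp only [IsLabel, Idx.toPt, labelPt, Matrix.cons_val]
  omega

theorem toPt_injective : Function.Injective Idx.toPt :=
  Function.LeftInverse.injective ptIdx_toPt

theorem ptLength_toPt (t : Idx) : ptLength t.toPt = t.N := by
  obtain ⟨N, x, y, hx, hy⟩ := t
  simp only [ptLength, Idx.toPt, labelPt, Matrix.cons_val]
  omega

/-- The basis vector at a lattice point, zero when the point does not come from a label. -/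
def ptVec (p : Pt) : H := if IsLabel p then e (ptIdx p) else 0

theorem ptVec_toPt (t : Idx) : ptVec t.toPt = e t := by
  rw [ptVec, if_pos (isLabel_toPt t), ptIdx_toPt]

theorem ptVec_of_not {p : Pt} (hp : ¬IsLabel p) : ptVec p = 0 := if_neg hp

theorem inner_ptVec (p q : Pt) : ⟪ptVec p, ptVec q⟫_ℂ = if IsLabel p ∧ p = q then 1 else 0 := by
  by_cases hp : IsLabel p
  · by_cases hq : IsLabel q
    · have ptIdx_inj : ptIdx p = ptIdx q ↔ p = q :=
        ⟨fun h => by rw [← toPt_ptIdx hp, h, toPt_ptIdx hq], fun h => by rw [h]⟩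
      rw [ptVec, ptVec, if_pos hp, if_pos hq, inner_e, e_apply]
      simp only [ptIdx_inj, hp, true_and]
    · rw [ptVec_of_not hq, inner_zero_right, if_neg]
      rintro ⟨h1, rfl⟩
      exact hq h1
  · rw [ptVec_of_not hp, inner_zero_left, if_neg fun h => hp h.1]

theorem hasSum_ptVec (ξ : H) : HasSum (fun p => ⟪ptVec p, ξ⟫_ℂ • ptVec p) ξ := by
  refine (toPt_injective.hasSum_iff fun p hp => ?_).1 ?_
  · rw [ptVec_of_not fun h => hp ⟨_, toPt_ptIdx h⟩, smul_zero]
  · simpa only [Function.comp_def, ptVec_toPt, inner_e] using hasSum_e ξ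

/-- The matrix of an operator, extended by zero to the lattice. -/
def opKernel (T : H →L[ℂ] H) (z : Pt × Pt) : ℂ := ⟪ptVec z.1, T (ptVec z.2)⟫_ℂ

theorem opKernel_toPt (T : H →L[ℂ] H) (i j : Idx) : opKernel T (i.toPt, j.toPt) = T (e j) i := by
  rw [opKernel, ptVec_toPt, ptVec_toPt, inner_e]

theorem opKernel_of_not {T : H →L[ℂ] H} {z : Pt × Pt} (h : ¬(IsLabel z.1 ∧ IsLabel z.2)) :
    opKernel T z = 0 := by
  rw [opKernel]
  by_cases h1 : IsLabel z.1
  · rw [ptVec_of_not fun h2 => h ⟨h1, h2⟩, map_zero, inner_zero_right]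
  · rw [ptVec_of_not h1, inner_zero_left]

theorem opKernel_eq {T : H →L[ℂ] H} {K : Pt × Pt → ℂ}
    (hK : ∀ z, ¬(IsLabel z.1 ∧ IsLabel z.2) → K z = 0)
    (h : ∀ i j : Idx, T (e j) i = K (i.toPt, j.toPt)) : opKernel T = K := by
  ext z
  by_cases hz : IsLabel z.1 ∧ IsLabel z.2
  · have := h (ptIdx z.1) (ptIdx z.2)
    rwa [← opKernel_toPt, toPt_ptIdx hz.1, toPt_ptIdx hz.2] at this
  · rw [opKernel_of_not hz, hK z hz]

theorem opKernel_mul (S T : H →L[ℂ] H) :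
    opKernel (S * T) = convKer (opKernel S) (opKernel T) := by
  ext z
  have h := (((hasSum_ptVec (T (ptVec z.2))).mapL S).mapL (innerSL ℂ (ptVec z.1))).tsum_eq
  simp only [map_smul, innerSL_apply_apply, smul_eq_mul] at h
  exact h.symm.trans (tsum_congr fun s => mul_comm _ _)

theorem opKernel_add (S T : H →L[ℂ] H) : opKernel (S + T) = opKernel S + opKernel T := by
  ext z
  simp [opKernel]

theorem opKernel_smul (c : ℂ) (T : H →L[ℂ] H) : opKernel (c • T) = c • opKernel T := by
  ext z
  simp [opKernel]

theorem opKernel_one (z : Pt × Pt) :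
    opKernel 1 z = if IsLabel z.1 ∧ z.1 = z.2 then 1 else 0 :=
  inner_ptVec z.1 z.2

theorem exists_diagonal {g : Pt → ℂ} {C : ℝ} (hg : ∀ p, ‖g p‖ ≤ C) (v : Pt) :
    ∃ T : H →L[ℂ] H, ‖T‖ ≤ C ∧
      ∀ i j : Idx, T (e j) i = if i.toPt - v = j.toPt then g i.toPt else 0 := by
  classical
  have C_nonneg : 0 ≤ C := (norm_nonneg _).trans (hg 0)
  let c (i : Idx) : ℂ := if IsLabel (i.toPt - v) then g i.toPt else 0
  have norm_c_le (i : Idx) : ‖c i‖ ≤ C := by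
    dsimp only [c]
    split_ifs
    exacts [hg _, by simpa using C_nonneg]
  have isLabel_of_mem {i : Idx} (hi : i ∈ Function.support c) : IsLabel (i.toPt - v) := by
    by_contra h
    exact hi (if_neg h)
  have injOn : Set.InjOn (fun i : Idx => ptIdx (i.toPt - v)) (Function.support c) := by
    intro i hi j hj hij
    have := congrArg Idx.toPt hij
    simp only [toPt_ptIdx (isLabel_of_mem hi), toPt_ptIdx (isLabel_of_mem hj),
      sub_left_inj] at this
    exact toPt_injective this
  refine ⟨weightedPull c _ C norm_c_le injOn,
    (LinearMap.mkContinuous_norm_le _ (abs_nonneg C) _).trans (abs_of_nonneg C_nonneg).le,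
    fun i j => ?_⟩
  rw [weightedPull_apply, e_apply]
  by_cases h : i.toPt - v = j.toPt
  · simp only [c, h, ptIdx_toPt, if_pos, isLabel_toPt, mul_one]
  · rw [if_neg h]
    by_cases hl : IsLabel (i.toPt - v)
    · rw [if_neg fun h2 => h (by rw [← h2, toPt_ptIdx hl]), mul_zero]
    · rw [show c i = 0 from if_neg hl, zero_mul]

theorem exists_op_of_rapid {K : Pt × Pt → ℂ} (hK : Rapid offDiag K)
    (h0 : ∀ z, ¬(IsLabel z.1 ∧ IsLabel z.2) → K z = 0) : ∃ T : H →L[ℂ] H, opKernel T = K := by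
  classical
  obtain ⟨C, -, hC⟩ := hK.exists_norm_le_mul_inv (2 * Fintype.card (Fin 3))
  have diagonal (v : Pt) := exists_diagonal (g := fun p => K (p, p - v))
    (fun p => by simpa [offDiag] using hC (p, p - v)) v
  choose T hT hT' using diagonal
  have summable_T : Summable T := Summable.of_norm_bounded
    ((summable_inv_offDiag_pow (0 : Pt)).mul_left C) fun v => by simpa [offDiag] using hT v
  refine ⟨∑' v, T v, opKernel_eq h0 fun i j => ?_⟩
  have hasSum_entry := (summable_T.hasSum.mapL (ContinuousLinearMap.apply ℂ H (e j))).mapL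
    (innerSL ℂ (e i))
  simp only [ContinuousLinearMap.apply_apply, innerSL_apply_apply, inner_e, hT'] at hasSum_entry
  refine hasSum_entry.unique ?_
  have := hasSum_single (f := fun v => if i.toPt - v = j.toPt then K (i.toPt, i.toPt - v) else 0)
    (i.toPt - j.toPt) fun v hv => if_neg fun h => hv (by rw [← h, sub_sub_cancel])
  simpa only [sub_sub_cancel, if_true] using this

/-! ### Smooth operators -/

/-- Operators with a smooth kernel. They form an algebra which is invariant under `δ` and contains
`𝒜`, and the traces of their products with powers of `|D|` can be computed. -/
def SmoothOp (T : H →L[ℂ] H) : Prop := SmoothKernel (opKernel T)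

theorem SmoothOp.add {S T : H →L[ℂ] H} (hS : SmoothOp S) (hT : SmoothOp T) : SmoothOp (S + T) := by
  rw [SmoothOp, opKernel_add]
  exact SmoothKernel.add hS hT

theorem SmoothOp.const_smul {T : H →L[ℂ] H} (hT : SmoothOp T) (c : ℂ) : SmoothOp (c • T) := by
  rw [SmoothOp, opKernel_smul]
  exact SmoothKernel.const_smul hT c

theorem SmoothOp.mul {S T : H →L[ℂ] H} (hS : SmoothOp S) (hT : SmoothOp T) : SmoothOp (S * T) := by
  rw [SmoothOp, opKernel_mul]
  exact SmoothKernel.conv hS hT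

theorem abs_diracEig (t : Idx) : |diracEig t| = t.N := by
  unfold diracEig
  split_ifs <;> simp

theorem isCommutator_diagOp_toPt {w : Pt → ℤ} {T S : H →L[ℂ] H} :
    IsCommutator (diagOp fun t => (w t.toPt : ℂ)) T S
      ↔ opKernel S = diffMultiplier w * opKernel T := by
  rw [isCommutator_diagOp]
  refine ⟨fun h => opKernel_eq (fun z hz => ?_) fun i j => ?_, fun h i j => ?_⟩
  · rw [Pi.mul_apply, opKernel_of_not hz, mul_zero]
  · rw [h, Pi.mul_apply, opKernel_toPt, diffMultiplier, Int.cast_sub]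
  · rw [← opKernel_toPt, h, Pi.mul_apply, opKernel_toPt, diffMultiplier, Int.cast_sub]

theorem exists_isCommutator_diagOp_toPt {w : Pt → ℤ} {T : H →L[ℂ] H}
    (h : SmoothKernel (diffMultiplier w * opKernel T)) :
    ∃ S, IsCommutator (diagOp fun t => (w t.toPt : ℂ)) T S := by
  obtain ⟨S, hS⟩ := exists_op_of_rapid h.rapid
    fun z hz => by rw [Pi.mul_apply, opKernel_of_not hz, mul_zero]
  exact ⟨S, isCommutator_diagOp_toPt.2 hS⟩

theorem absDirac_eq : absDirac = diagOp fun t => (ptLength t.toPt : ℂ) := by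
  simp only [absDirac, abs_diracEig, ptLength_toPt, Complex.ofReal_natCast, Int.cast_natCast]

theorem SmoothOp.of_isCommutator_absDirac {T S : H →L[ℂ] H} (hT : SmoothOp T)
    (h : IsCommutator absDirac T S) : SmoothOp S := by
  rw [absDirac_eq, isCommutator_diagOp_toPt] at h
  rw [SmoothOp, h]
  exact SmoothKernel.diffMultiplier_ptLength_mul hT

theorem SmoothOp.exists_isCommutator_absDirac {T : H →L[ℂ] H} (hT : SmoothOp T) :
    ∃ S, IsCommutator absDirac T S := by
  rw [absDirac_eq]
  exact exists_isCommutator_diagOp_toPt (SmoothKernel.diffMultiplier_ptLength_mul hT)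

theorem SmoothOp.of_isDelta {T : H →L[ℂ] H} (hT : SmoothOp T) :
    ∀ {k : ℕ} {S : H →L[ℂ] H}, IsDelta k T S → SmoothOp S
  | 0, _, h => by rwa [show _ = T from h]
  | _ + 1, _, ⟨_, h1, h2⟩ => (hT.of_isDelta h1).of_isCommutator_absDirac h2

theorem SmoothOp.exists_isDelta {T : H →L[ℂ] H} (hT : SmoothOp T) : ∀ k, ∃ S, IsDelta k T S
  | 0 => ⟨T, rfl⟩
  | k + 1 => by
    obtain ⟨R, hR⟩ := hT.exists_isDelta k
    obtain ⟨S, hS⟩ := (hT.of_isDelta hR).exists_isCommutator_absDirac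
    exact ⟨S, R, hR, hS⟩

/-! ### Fourier coefficients of smooth functions -/

theorem IsSmoothCircle.deriv {f : ℝ → ℂ} (hf : IsSmoothCircle f) : IsSmoothCircle (deriv f) := by
  refine ⟨fun x => ?_, ((contDiff_infty_iff_deriv (𝕜 := ℝ)).1 hf.2).2⟩
  rw [← deriv_comp_add_const, show (fun y => f (y + 2 * Real.pi)) = f from funext hf.1]

theorem norm_fourierCoeffOn_le {f : ℝ → ℂ} {C : ℝ} (hC : ∀ θ, ‖f θ‖ ≤ C) (n : ℤ) :
    ‖fourierCoeffOn Real.two_pi_pos f n‖ ≤ C := by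
  have norm_integral_le := intervalIntegral.norm_integral_le_of_norm_le_const (a := 0)
    (b := 2 * Real.pi) (f := fun x : ℝ => fourier (-n) (x : AddCircle (2 * Real.pi - 0)) • f x)
    (C := C) fun x _ => by
      rw [norm_smul, fourier_apply, Circle.norm_coe, one_mul]
      exact hC x
  rw [sub_zero, abs_of_pos Real.two_pi_pos] at norm_integral_le
  rw [fourierCoeffOn_eq_integral, norm_smul, sub_zero, Real.norm_of_nonneg (by positivity)]
  calc _ ≤ 1 / (2 * Real.pi) * (C * (2 * Real.pi)) :=
        mul_le_mul_of_nonneg_left norm_integral_le (by positivity)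
    _ = C := by field_simp

theorem fourierCoeffOn_deriv {f : ℝ → ℂ} (hf : IsSmoothCircle f) (n : ℤ) :
    fourierCoeffOn Real.two_pi_pos (deriv f) n
      = Complex.I * n * fourierCoeffOn Real.two_pi_pos f n := by
  have differentiable : Differentiable ℝ f := hf.2.differentiable (by simp)
  have integrable : IntervalIntegrable (deriv f) MeasureTheory.volume 0 (2 * Real.pi) :=
    hf.deriv.2.continuous.intervalIntegrable _ _
  have endpoints : f (2 * Real.pi) - f 0 = 0 := by
    rw [← zero_add (2 * Real.pi), hf.1 0, sub_self]
  by_cases hn : n = 0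
  · have : ∫ x in (0 : ℝ)..2 * Real.pi, deriv f x = 0 := by
      rw [intervalIntegral.integral_deriv_eq_sub (fun x _ => differentiable x) integrable,
        endpoints]
    subst hn
    rw [fourierCoeffOn_eq_integral]
    simp [this]
  · have hn' : (n : ℂ) ≠ 0 := mod_cast hn
    have hπ : (Real.pi : ℂ) ≠ 0 := mod_cast Real.pi_ne_zero
    rw [fourierCoeffOn_of_hasDerivAt Real.two_pi_pos hn
      (fun x _ => (differentiable x).hasDerivAt) integrable, endpoints]
    push_cast
    field_simp
    ring

theorem norm_pow_mul_fourierCoeffOn_le {f : ℝ → ℂ} (hf : IsSmoothCircle f) (j : ℕ) {C : ℝ}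
    (hC : ∀ θ, ‖iteratedDeriv j f θ‖ ≤ C) (n : ℤ) :
    (n.natAbs : ℝ) ^ j * ‖fourierCoeffOn Real.two_pi_pos f n‖ ≤ C := by
  induction j generalizing f with
  | zero => simpa using norm_fourierCoeffOn_le (by simpa using hC) n
  | succ j ih =>
    have := ih hf.deriv (by simpa only [iteratedDeriv_succ'] using hC)
    rw [fourierCoeffOn_deriv hf, norm_mul, norm_mul, Complex.norm_I, one_mul,
      Complex.norm_intCast, ← Int.cast_abs, ← Nat.cast_natAbs] at this
    rwa [pow_succ, mul_assoc]

/-- The Fourier coefficients of a double sequence of functions, as a function on `ℕ × ℕ × ℤ`. -/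
def fourierFamily (f : ℕ → ℕ → ℝ → ℂ) (x : ℕ × ℕ × ℤ) : ℂ :=
  fourierCoeffOn Real.two_pi_pos (f x.1 x.2.1) x.2.2

/-- The weight measuring the decay of the Fourier coefficients of a double sequence. -/
def fourierWeight (x : ℕ × ℕ × ℤ) : ℕ := x.1 + x.2.1 + x.2.2.natAbs

theorem RapidDecaySmooth.rapid {f : ℕ → ℕ → ℝ → ℂ} (hf : RapidDecaySmooth f) :
    Rapid fourierWeight (fourierFamily f) := by
  refine Rapid.add_weight (w := fun x : ℕ × ℕ × ℤ => x.1 + x.2.1)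
    (w' := fun x : ℕ × ℕ × ℤ => x.2.2.natAbs) (fun r => ?_) fun r => ?_
  · obtain ⟨C, hC⟩ := hf.2 r 0
    refine ⟨C, fun ⟨k, l, n⟩ => ?_⟩
    have h0 : (0 : ℝ) < (1 + (k : ℝ) + l) ^ r := by positivity
    have coeff_le : ‖fourierCoeffOn Real.two_pi_pos (f k l) n‖ ≤ C / (1 + (k : ℝ) + l) ^ r := by
      refine norm_fourierCoeffOn_le (fun θ => ?_) n
      rw [le_div_iff₀ h0, mul_comm]
      simpa using hC k l θ
    rw [le_div_iff₀ h0, mul_comm, add_assoc] at coeff_le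
    simpa [fourierFamily] using coeff_le
  · obtain ⟨C, hC⟩ := hf.2 0 0
    obtain ⟨C', hC'⟩ := hf.2 0 r
    refine ⟨2 ^ (r - 1) * (C + C'), fun ⟨k, l, n⟩ => ?_⟩
    have coeff_le := norm_fourierCoeffOn_le (C := C) (fun θ => by simpa using hC k l θ) n
    have pow_mul_coeff_le := norm_pow_mul_fourierCoeffOn_le (hf.1 k l) r (C := C')
      (fun θ => by simpa using hC' k l θ) n
    calc _ ≤ 2 ^ (r - 1) * (1 ^ r + (n.natAbs : ℝ) ^ r)
          * ‖fourierCoeffOn Real.two_pi_pos (f k l) n‖ :=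
          mul_le_mul_of_nonneg_right (add_pow_le zero_le_one (by positivity) r) (norm_nonneg _)
      _ = 2 ^ (r - 1) * (‖fourierCoeffOn Real.two_pi_pos (f k l) n‖ + (n.natAbs : ℝ) ^ r
          * ‖fourierCoeffOn Real.two_pi_pos (f k l) n‖) := by rw [one_pow]; ring
      _ ≤ _ := by gcongr

theorem Rapid.summable_fourierWeight {F : ℕ × ℕ × ℤ → ℂ} (hF : Rapid fourierWeight F) :
    Summable fun x : (ℕ × ℕ) × ℤ => ‖F (x.1.1, x.1.2, x.2)‖ := by
  obtain ⟨C, -, hC⟩ := hF.exists_norm_le_mul_inv (2 * Fintype.card (Fin 3))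
  have injective : Function.Injective
      fun x : (ℕ × ℕ) × ℤ => (![(x.1.1 : ℤ), x.1.2, x.2] : Pt) := by
    rintro ⟨⟨a, b⟩, c⟩ ⟨⟨a', b'⟩, c'⟩ hx
    simpa [and_assoc] using hx
  refine .of_norm_bounded
    (((summable_inv_offDiag_pow (0 : Pt)).mul_left C).comp_injective injective) fun x => ?_
  rw [norm_norm]
  refine (hC _).trans (le_of_eq ?_)
  simp [fourierWeight, offDiag, Fin.sum_univ_three]

/-! ### The kernels of `α` and `β` -/

theorem pt_ext_iff {p q : Pt} : p = q ↔ p 0 = q 0 ∧ p 1 = q 1 ∧ p 2 = q 2 := by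
  rw [funext_iff, Fin.forall_fin_succ, Fin.forall_fin_two]
  rfl

theorem hasSum_opKernel {κ : Type*} {T : κ → H →L[ℂ] H} (hT : Summable T) (z : Pt × Pt) :
    HasSum (fun i => opKernel (T i) z) (opKernel (∑' i, T i) z) :=
  (hT.hasSum.mapL (ContinuousLinearMap.apply ℂ H (ptVec z.2))).mapL (innerSL ℂ (ptVec z.1))

theorem inner_star_right {E : Type*} [NormedAddCommGroup E] [InnerProductSpace ℂ E]
    [CompleteSpace E] (T : E →L[ℂ] E) (ξ η : E) : ⟪ξ, star T η⟫_ℂ = ⟪T ξ, η⟫_ℂ := by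
  rw [ContinuousLinearMap.star_eq_adjoint, ContinuousLinearMap.adjoint_inner_right]

theorem opKernel_star (T : H →L[ℂ] H) (z : Pt × Pt) :
    opKernel (star T) z = (starRingEnd ℂ) (opKernel T z.swap) := by
  rw [opKernel, opKernel, inner_star_right, inner_conj_symm]
  rfl

theorem norm_pow_le_one {E : Type*} [SeminormedAddCommGroup E] [NormedSpace ℂ E] {T : E →L[ℂ] E}
    (hT : ‖T‖ ≤ 1) : ∀ n, ‖T ^ n‖ ≤ 1
  | 0 => ContinuousLinearMap.norm_id_le
  | n + 1 => (norm_pow_le' T n.succ_pos).trans (pow_le_one₀ (norm_nonneg _) hT)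

theorem norm_weightedPull_le (c : Idx → ℂ) (φ : Idx → Idx) (C : ℝ) (hc : ∀ i, ‖c i‖ ≤ C)
    (hφ : Set.InjOn φ (Function.support c)) : ‖weightedPull c φ C hc hφ‖ ≤ |C| :=
  LinearMap.mkContinuous_norm_le _ (abs_nonneg _) _

theorem norm_alpha_pow_le (n : ℕ) : ‖alpha ^ n‖ ≤ 1 :=
  norm_pow_le_one ((norm_weightedPull_le _ _ _ _ _).trans abs_one.le) n

theorem norm_beta_le : ‖beta‖ ≤ 1 := (norm_weightedPull_le _ _ _ _ _).trans abs_one.le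

theorem norm_betaPow_le (n : ℤ) : ‖betaPow n‖ ≤ 1 := by
  have norm_star_beta_le : ‖star beta‖ ≤ 1 := (norm_star beta).trans_le norm_beta_le
  unfold betaPow
  split_ifs
  · exact (norm_mul_le _ _).trans (mul_le_one₀ norm_star_beta_le (norm_nonneg _) norm_beta_le)
  · exact norm_pow_le_one norm_beta_le _
  · exact norm_pow_le_one norm_star_beta_le _

theorem alpha_ptVec (p : Pt) : alpha (ptVec p) = ptVec (p - Pi.single 0 1) := by
  by_cases hp : IsLabel p
  · rw [ptVec, if_pos hp, alpha_e]
    by_cases hp' : IsLabel (p - Pi.single 0 1)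
    · rw [ptVec, if_pos hp', if_pos]
      · congr 1
        simp only [IsLabel, ptIdx, Pi.sub_apply, Pi.single_apply, Fin.reduceEq, if_true, if_false,
          Idx.mk.injEq] at hp hp' ⊢
        omega
      · simp only [IsLabel, ptIdx, Pi.sub_apply, Pi.single_apply, if_true] at hp hp' ⊢
        omega
    · rw [ptVec_of_not hp', if_neg]
      simp only [IsLabel, ptIdx, Pi.sub_apply, Pi.single_apply, Fin.reduceEq, if_true,
        if_false] at hp hp' ⊢
      omega
  · rw [ptVec_of_not hp, map_zero, ptVec_of_not]
    simp only [IsLabel, Pi.sub_apply, Pi.single_apply, Fin.reduceEq, if_true, if_false] at hp ⊢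
    omega

theorem alpha_pow_ptVec (l : ℕ) (p : Pt) :
    (alpha ^ l) (ptVec p) = ptVec (p - Pi.single 0 (l : ℤ)) := by
  induction l generalizing p with
  | zero => simp
  | succ l ih =>
    rw [pow_succ, mul_apply_eq_comp, alpha_ptVec, ih, sub_sub, ← Pi.single_add,
      add_comm (1 : ℤ), Nat.cast_succ]

theorem opKernel_star_alpha_pow_mul_mul_alpha_pow (T : H →L[ℂ] H) (k l : ℕ) (z : Pt × Pt) :
    opKernel (star alpha ^ k * T * alpha ^ l) z
      = opKernel T (z.1 - Pi.single 0 (k : ℤ), z.2 - Pi.single 0 (l : ℤ)) := by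
  rw [opKernel, opKernel, ← alpha_pow_ptVec, ← alpha_pow_ptVec, ← star_pow,
    ← inner_star_right]
  rfl

/-- The sign by which the action of `β` differs from a shift. -/
def shiftSign (m : ℤ) : ℂ := (-1) ^ m.toNat

theorem shiftSign_mul_self (m : ℤ) : shiftSign m * shiftSign m = 1 := by
  rw [shiftSign, ← mul_pow, neg_one_mul, neg_neg, one_pow]

theorem norm_shiftSign (m : ℤ) : ‖shiftSign m‖ = 1 := by
  rw [shiftSign, norm_pow, norm_neg, norm_one, one_pow]

theorem conj_shiftSign (m : ℤ) : (starRingEnd ℂ) (shiftSign m) = shiftSign m := by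
  rw [shiftSign, map_pow, map_neg, map_one]

theorem shiftSign_add_one (m : ℤ) :
    shiftSign (m + 1) = if 0 ≤ m then -shiftSign m else shiftSign m := by
  unfold shiftSign
  split_ifs with hm
  · rw [show (m + 1).toNat = m.toNat + 1 by omega, pow_succ, mul_neg_one]
  · rw [show (m + 1).toNat = m.toNat by omega]

theorem shiftSign_mul_shiftSign_add_one (m : ℤ) :
    shiftSign m * shiftSign (m + 1) = if 0 ≤ m then -1 else 1 := by
  rw [shiftSign_add_one, mul_ite, mul_neg, shiftSign_mul_self]

theorem beta_ptVec (p : Pt) : beta (ptVec p) = if p 0 = 0 then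
    (shiftSign (p 1) * shiftSign (p 1 + 1)) • ptVec (p + Pi.single 1 1) else 0 := by
  have isLabel_iff : IsLabel (p + Pi.single 1 1) ↔ IsLabel p := by
    simp only [IsLabel, Pi.add_apply, Pi.single_apply, Fin.reduceEq, if_false, add_zero]
  by_cases hp : IsLabel p
  · rw [ptVec, ptVec, if_pos hp, if_pos (isLabel_iff.2 hp), beta_e, shiftSign_mul_shiftSign_add_one]
    simp only [IsLabel] at hp
    by_cases hz : p 0 = 0
    · rw [if_pos hz]
      by_cases h1 : 0 ≤ p 1
      · rw [if_pos h1, if_pos (by simp only [ptIdx]; omega), neg_one_smul]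
        congr 2
        simp only [ptIdx, Pi.add_apply, Pi.single_apply, Fin.reduceEq, if_true, if_false,
          Idx.mk.injEq]
        omega
      · rw [if_neg h1, if_neg (by simp only [ptIdx]; omega), if_pos (by simp only [ptIdx]; omega),
          one_smul]
        congr 1
        simp only [ptIdx, Pi.add_apply, Pi.single_apply, Fin.reduceEq, if_true, if_false,
          Idx.mk.injEq]
        omega
    · rw [if_neg hz, if_neg (by simp only [ptIdx]; omega), if_neg (by simp only [ptIdx]; omega)]
  · rw [ptVec_of_not hp, ptVec_of_not (mt isLabel_iff.1 hp), map_zero, smul_zero, ite_self]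

theorem beta_pow_ptVec {n : ℕ} (hn : n ≠ 0) (p : Pt) : (beta ^ n) (ptVec p) = if p 0 = 0 then
    (shiftSign (p 1) * shiftSign (p 1 + n)) • ptVec (p + Pi.single 1 (n : ℤ)) else 0 := by
  split_ifs with hp
  · clear hn
    induction n with
    | zero => simp [shiftSign_mul_self]
    | succ n ih =>
      have cancel : shiftSign (p 1) * shiftSign (p 1 + n)
          * (shiftSign (p 1 + n) * shiftSign (p 1 + n + 1))
          = shiftSign (p 1) * shiftSign (p 1 + n + 1) := by
        rw [mul_assoc, ← mul_assoc (shiftSign (p 1 + n)), shiftSign_mul_self, one_mul]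
      rw [pow_succ', mul_apply_eq_comp, ih, map_smul, beta_ptVec,
        if_pos (by simpa using hp), smul_smul, add_assoc, ← Pi.single_add, Pi.add_apply,
        Pi.single_eq_same, cancel, Nat.cast_succ, add_assoc]
  · obtain ⟨n, rfl⟩ := Nat.exists_eq_succ_of_ne_zero hn
    rw [pow_succ, mul_apply_eq_comp, beta_ptVec, if_neg hp, map_zero]

/-- The kernel of `betaPow n`. -/
def betaKernel (n : ℤ) (z : Pt × Pt) : ℂ :=
  if IsLabel z.1 ∧ z.1 0 = 0 ∧ z.2 0 = 0 ∧ z.1 2 = z.2 2 ∧ z.1 1 - z.2 1 = n then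
    shiftSign (z.1 1) * shiftSign (z.2 1) else 0

theorem conj_betaKernel_swap (n : ℤ) (z : Pt × Pt) :
    (starRingEnd ℂ) (betaKernel n z.swap) = betaKernel (-n) z := by
  rw [betaKernel, betaKernel, apply_ite (starRingEnd ℂ), map_mul, map_zero, conj_shiftSign,
    conj_shiftSign, mul_comm]
  refine if_congr ?_ rfl rfl
  simp only [IsLabel, Prod.fst_swap, Prod.snd_swap]
  omega

theorem opKernel_beta_pow {n : ℕ} (hn : n ≠ 0) : opKernel (beta ^ n) = betaKernel n := by
  ext ⟨p, q⟩
  rw [opKernel, beta_pow_ptVec hn, betaKernel]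
  by_cases hq : q 0 = 0
  · rw [if_pos hq, inner_smul_right, inner_ptVec, mul_ite, mul_one, mul_zero]
    simp only [pt_ext_iff]
    refine ite_congr (propext ?_) (fun h => ?_) fun _ => rfl
    · simp only [IsLabel, Pi.add_apply, Pi.single_apply, Fin.reduceEq, if_true, if_false]
      omega
    · rw [show q 1 + (n : ℤ) = p 1 by omega, mul_comm]
  · rw [if_neg hq, inner_zero_right, if_neg (by tauto)]

theorem opKernel_star_beta_mul_beta : opKernel (star beta * beta) = betaKernel 0 := by
  ext ⟨p, q⟩
  have inner_eq : opKernel (star beta * beta) (p, q) = ⟪beta (ptVec p), beta (ptVec q)⟫_ℂ := by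
    change ⟪ptVec p, star beta (beta (ptVec q))⟫_ℂ = _
    rw [inner_star_right]
  rw [inner_eq, beta_ptVec, beta_ptVec, betaKernel]
  by_cases hp : p 0 = 0
  · by_cases hq : q 0 = 0
    · rw [if_pos hp, if_pos hq, inner_smul_left, inner_smul_right, inner_ptVec, map_mul,
        conj_shiftSign, conj_shiftSign, mul_ite, mul_ite, mul_one, mul_zero, mul_zero]
      simp only [pt_ext_iff]
      refine ite_congr (propext ?_) (fun h => ?_) fun _ => rfl
      · simp only [IsLabel, Pi.add_apply, Pi.single_apply, Fin.reduceEq, if_true, if_false]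
        omega
      · rw [show q 1 = p 1 by omega, mul_mul_mul_comm, shiftSign_mul_self, shiftSign_mul_self,
          one_mul]
    · rw [if_neg hq, inner_zero_right, if_neg (by tauto)]
  · rw [if_neg hp, inner_zero_left, if_neg (by tauto)]

theorem opKernel_betaPow (n : ℤ) : opKernel (betaPow n) = betaKernel n := by
  unfold betaPow
  split_ifs with h0 hpos
  · rw [h0, opKernel_star_beta_mul_beta]
  · rw [opKernel_beta_pow (by omega), Int.toNat_of_nonneg hpos.le]
  · ext z
    rw [← star_pow, opKernel_star, opKernel_beta_pow (by omega), conj_betaKernel_swap,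
      Int.toNat_of_nonneg (by omega), neg_neg]

/-- The powers of `α`, the negative ones being powers of `α*`. -/
def alphaPow : ℤ → H →L[ℂ] H
  | .ofNat l => alpha ^ l
  | .negSucc k => star alpha ^ (k + 1)

theorem norm_alphaPow_le : ∀ n, ‖alphaPow n‖ ≤ 1
  | .ofNat l => norm_alpha_pow_le l
  | .negSucc k => by
    rw [alphaPow, ← star_pow]
    exact (norm_star _).trans_le (norm_alpha_pow_le (k + 1))

theorem opKernel_alphaPow (n : ℤ) (z : Pt × Pt) : opKernel (alphaPow n) z =
    if IsLabel z.1 ∧ IsLabel z.2 ∧ z.1 1 = z.2 1 ∧ z.1 2 = z.2 2 ∧ z.2 0 - z.1 0 = n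
    then 1 else 0 := by
  have opKernel_alpha_pow (l : ℕ) (z : Pt × Pt) : opKernel (alpha ^ l) z =
      if IsLabel z.1 ∧ IsLabel z.2 ∧ z.1 1 = z.2 1 ∧ z.1 2 = z.2 2 ∧ z.2 0 - z.1 0 = l
      then 1 else 0 := by
    rw [opKernel, alpha_pow_ptVec, inner_ptVec]
    refine if_congr ?_ rfl rfl
    simp only [IsLabel, pt_ext_iff, Pi.sub_apply, Pi.single_apply, Fin.reduceEq, if_true, if_false]
    omega
  cases n with
  | ofNat l => exact opKernel_alpha_pow l z
  | negSucc k =>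
    rw [alphaPow, ← star_pow, opKernel_star, opKernel_alpha_pow, apply_ite (starRingEnd ℂ), map_one,
      map_zero]
    refine if_congr ?_ rfl rfl
    simp only [IsLabel, Prod.fst_swap, Prod.snd_swap]
    omega

/-! ### The kernels of the elements of `𝒜` -/

theorem opKernel_tsum {κ : Type*} {T : κ → H →L[ℂ] H} (hT : Summable T) {z : Pt × Pt} (i : κ)
    (h : ∀ j ≠ i, opKernel (T j) z = 0) : opKernel (∑' j, T j) z = opKernel (T i) z :=
  (hasSum_opKernel hT z).unique (hasSum_single i h)

theorem summable_smul_of_norm_le_one {κ E : Type*} [NormedAddCommGroup E] [NormedSpace ℂ E]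
    [CompleteSpace E] {c : κ → ℂ} {v : κ → E} (hc : Summable fun i => ‖c i‖)
    (hv : ∀ i, ‖v i‖ ≤ 1) : Summable fun i => c i • v i :=
  .of_norm_bounded hc fun i => by
    rw [norm_smul]
    exact mul_le_of_le_one_right (norm_nonneg _) (hv i)

theorem norm_funBeta_le {f : ℝ → ℂ}
    (hf : Summable fun n : ℤ => ‖fourierCoeffOn Real.two_pi_pos f n‖) :
    ‖funBeta f‖ ≤ ∑' n : ℤ, ‖fourierCoeffOn Real.two_pi_pos f n‖ :=
  tsum_of_norm_bounded hf.hasSum fun n => by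
    rw [norm_smul]
    exact mul_le_of_le_one_right (norm_nonneg _) (norm_betaPow_le n)

theorem opKernel_funBeta {f : ℝ → ℂ}
    (hf : Summable fun n : ℤ => ‖fourierCoeffOn Real.two_pi_pos f n‖) (z : Pt × Pt) :
    opKernel (funBeta f) z = fourierCoeffOn Real.two_pi_pos f (z.1 1 - z.2 1)
      * betaKernel (z.1 1 - z.2 1) z := by
  rw [funBeta, opKernel_tsum (summable_smul_of_norm_le_one hf norm_betaPow_le) (z.1 1 - z.2 1),
    opKernel_smul, opKernel_betaPow, Pi.smul_apply, smul_eq_mul]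
  intro n hn
  rw [opKernel_smul, opKernel_betaPow, Pi.smul_apply, betaKernel, if_neg (by tauto), smul_zero]

/-- The kernel of `∑ α*ᵏ f_{kl}(β) αˡ`, in terms of the Fourier coefficients of the `f_{kl}`. -/
def compactKernel (F : ℕ × ℕ × ℤ → ℂ) (z : Pt × Pt) : ℂ :=
  if IsLabel z.1 ∧ IsLabel z.2 ∧ z.1 2 = z.2 2 then
    F ((z.1 0).toNat, (z.2 0).toNat, z.1 1 - z.2 1) * (shiftSign (z.1 1) * shiftSign (z.2 1))
  else 0

theorem summable_star_alpha_pow_mul_funBeta_mul_alpha_pow {f : ℕ → ℕ → ℝ → ℂ}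
    (hf : RapidDecaySmooth f) :
    Summable fun p : ℕ × ℕ => star alpha ^ p.1 * funBeta (f p.1 p.2) * alpha ^ p.2 := by
  refine .of_norm_bounded hf.rapid.summable_fourierWeight.prod fun ⟨k, l⟩ => ?_
  have norm_star_alpha_pow_le : ‖star alpha ^ k‖ ≤ 1 := by
    rw [← star_pow]
    exact (norm_star _).trans_le (norm_alpha_pow_le k)
  calc _ ≤ ‖star alpha ^ k‖ * ‖funBeta (f k l)‖ * ‖alpha ^ l‖ :=
        (norm_mul_le _ _).trans (mul_le_mul_of_nonneg_right (norm_mul_le _ _) (norm_nonneg _))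
    _ ≤ 1 * ‖funBeta (f k l)‖ * 1 := by gcongr; exact norm_alpha_pow_le l
    _ ≤ _ := by
      rw [one_mul, mul_one]
      exact norm_funBeta_le (hf.rapid.summable_fourierWeight.prod_factor (k, l))

theorem opKernel_tsum_funBeta {f : ℕ → ℕ → ℝ → ℂ} (hf : RapidDecaySmooth f) :
    opKernel (∑' p : ℕ × ℕ, star alpha ^ p.1 * funBeta (f p.1 p.2) * alpha ^ p.2)
      = compactKernel (fourierFamily f) := by
  ext z
  have summable_coeff (k l : ℕ) :
      Summable fun n : ℤ => ‖fourierCoeffOn Real.two_pi_pos (f k l) n‖ :=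
    hf.rapid.summable_fourierWeight.prod_factor (k, l)
  have opKernel_summand (k l : ℕ) :
      opKernel (star alpha ^ k * funBeta (f k l) * alpha ^ l) z
        = if IsLabel z.1 ∧ IsLabel z.2 ∧ z.1 2 = z.2 2 ∧ k = (z.1 0).toNat ∧ l = (z.2 0).toNat then
          fourierFamily f (k, l, z.1 1 - z.2 1) * (shiftSign (z.1 1) * shiftSign (z.2 1))
        else 0 := by
    rw [opKernel_star_alpha_pow_mul_mul_alpha_pow,
      opKernel_funBeta (summable_coeff k l), betaKernel, mul_ite,
      mul_zero]
    simp only [IsLabel, Pi.sub_apply, Pi.single_apply, Fin.reduceEq, if_true, if_false, sub_zero,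
      and_true]
    refine if_congr ?_ rfl rfl
    omega
  rw [opKernel_tsum (summable_star_alpha_pow_mul_funBeta_mul_alpha_pow hf)
    ((z.1 0).toNat, (z.2 0).toNat), opKernel_summand, compactKernel]
  · simp only [and_true]
  · rintro ⟨k, l⟩ hkl
    rw [opKernel_summand, if_neg]
    rintro ⟨-, -, -, rfl, rfl⟩
    exact hkl rfl

/-- The kernel of `∑ c_n αⁿ`, where `αⁿ` stands for `(α*)⁻ⁿ` if `n < 0`. -/
def toeplitzKernel (c : ℤ → ℂ) (z : Pt × Pt) : ℂ :=
  if IsLabel z.1 ∧ IsLabel z.2 ∧ z.1 1 = z.2 1 ∧ z.1 2 = z.2 2 then c (z.2 0 - z.1 0) else 0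

theorem Rapid.int_rec {E : Type*} [SeminormedAddCommGroup E] {f g : ℕ → E} (hf : Rapid id f)
    (hg : Rapid id g) : Rapid Int.natAbs (Int.rec f g : ℤ → E) := fun r => by
  obtain ⟨C, hC⟩ := hf r
  obtain ⟨C', hC'⟩ := hg.of_weight_le (w' := fun k => k + 1) 2
    (fun k _ => by simp only [id]; omega) r
  refine ⟨max C C', ?_⟩
  rintro (l | k)
  · exact (hC l).trans (le_max_left _ _)
  · exact (hC' k).trans (le_max_right _ _)

theorem opKernel_tsum_alpha_pow_add {lam lam' : ℕ → ℂ} (h : Rapid id lam) (h' : Rapid id lam') :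
    opKernel ((∑' l, lam l • alpha ^ l) + ∑' k, lam' k • star alpha ^ (k + 1))
      = toeplitzKernel (Int.rec lam lam') := by
  have summable_pos : Summable fun l => lam l • alpha ^ l :=
    summable_smul_of_norm_le_one h.summable_norm norm_alpha_pow_le
  have summable_neg : Summable fun k => lam' k • star alpha ^ (k + 1) :=
    summable_smul_of_norm_le_one h'.summable_norm fun k => norm_alphaPow_le (.negSucc k)
  have hasSum : HasSum (fun n : ℤ => (Int.rec lam lam' n : ℂ) • alphaPow n) _ :=
    HasSum.of_nat_of_neg_add_one summable_pos.hasSum summable_neg.hasSum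
  ext z
  rw [← hasSum.tsum_eq, opKernel_tsum hasSum.summable (z.2 0 - z.1 0), opKernel_smul,
    Pi.smul_apply, opKernel_alphaPow, toeplitzKernel]
  · simp only [and_true, smul_eq_mul, mul_ite, mul_one, mul_zero]
  · intro n hn
    rw [opKernel_smul, Pi.smul_apply, opKernel_alphaPow, if_neg (by tauto), smul_zero]

theorem exists_opKernel_eq_of_mem_smoothAlg {a : H →L[ℂ] H} (ha : a ∈ smoothAlg) :
    ∃ F c, Rapid fourierWeight F ∧ Rapid Int.natAbs c ∧
      opKernel a = compactKernel F + toeplitzKernel c := by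
  obtain ⟨f, lam, lam', hf, (h : Rapid id lam), (h' : Rapid id lam'), rfl⟩ := ha
  refine ⟨fourierFamily f, Int.rec lam lam', hf.rapid, .int_rec h h', ?_⟩
  rw [add_assoc, opKernel_add, opKernel_tsum_funBeta hf, opKernel_tsum_alpha_pow_add h h']

theorem rapid_compactKernel {F : ℕ × ℕ × ℤ → ℂ} (hF : Rapid fourierWeight F) :
    Rapid (dirWeight 0) (compactKernel F) := by
  refine (hF.comp fun z : Pt × Pt => ((z.1 0).toNat, (z.2 0).toNat, z.1 1 - z.2 1)).of_le 2 0 1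
    (fun z hz => ?_) fun z => ?_
  · have hz : IsLabel z.1 ∧ IsLabel z.2 ∧ z.1 2 = z.2 2 := by
      by_contra h
      exact hz (if_neg h)
    simp only [IsLabel] at hz
    simp only [Function.comp, fourierWeight, dirWeight, offDiag, Fin.sum_univ_three]
    omega
  · rw [compactKernel, pow_zero, mul_one, one_mul]
    split_ifs
    · rw [norm_mul, norm_mul, norm_shiftSign, norm_shiftSign, mul_one, mul_one]
      rfl
    · exact norm_zero.trans_le (norm_nonneg _)

theorem shiftSign_add_one_mul_shiftSign_add_one {m n : ℤ} (h : 0 ≤ m ↔ 0 ≤ n) :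
    shiftSign (m + 1) * shiftSign (n + 1) = shiftSign m * shiftSign n := by
  simp only [shiftSign_add_one, h]
  split_ifs
  · rw [neg_mul_neg]
  · rfl

theorem natAbs_le_of_shiftDiff_compactKernel_ne_zero {F : ℕ × ℕ × ℤ → ℂ} {i : Fin 3} (hi : i ≠ 0)
    {z : Pt × Pt} (hz : shiftDiff i (compactKernel F) z ≠ 0) :
    (z.1 i).natAbs ≤ offDiag z + 1 := by
  by_contra! hlt
  refine hz (sub_eq_zero.2 (ite_congr (propext ?_) (fun _ => ?_) fun _ => rfl))
  all_goals
    simp only [offDiag, Fin.sum_univ_three] at hlt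
    obtain rfl | rfl : i = 1 ∨ i = 2 := by omega
  any_goals
    simp only [IsLabel, shift, Pi.add_apply, Pi.single_apply, Fin.reduceEq, if_true, if_false]
  any_goals omega
  · rw [shiftSign_add_one_mul_shiftSign_add_one (by omega)]
    simp only [add_zero, add_sub_add_right_eq_sub]
  · simp only [add_zero]

theorem smoothKernel_compactKernel {F : ℕ × ℕ × ℤ → ℂ} (hF : Rapid fourierWeight F) :
    SmoothKernel (compactKernel F) := by
  have rapid0 := rapid_compactKernel hF
  have rapid : Rapid offDiag (compactKernel F) :=
    rapid0.of_weight_le 1 fun z _ => by simp only [dirWeight]; omega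
  refine ⟨rapid, fun i => ?_⟩
  by_cases hi : i = 0
  · subst hi
    refine Rapid.sub ((rapid0.comp (shift 0)).of_weight_le 2 fun z _ => ?_) rapid0
    have : (shift 0 z).1 0 = z.1 0 + 1 := by simp only [shift, Pi.add_apply, Pi.single_eq_same]
    simp only [Function.comp, dirWeight, offDiag_shift]
    omega
  · refine (rapid.shiftDiff i).of_weight_le 2 fun z hz => ?_
    have := natAbs_le_of_shiftDiff_compactKernel_ne_zero hi hz
    simp only [dirWeight]
    omega

theorem smoothKernel_toeplitzKernel {c : ℤ → ℂ} (hc : Rapid Int.natAbs c) :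
    SmoothKernel (toeplitzKernel c) := by
  refine .of_support ?_ fun i z hz => ?_
  · refine (hc.comp fun z : Pt × Pt => z.2 0 - z.1 0).of_le 1 0 1 (fun z hz => ?_) fun z => ?_
    · have hz : IsLabel z.1 ∧ IsLabel z.2 ∧ z.1 1 = z.2 1 ∧ z.1 2 = z.2 2 := by
        by_contra h
        exact hz (if_neg h)
      simp only [Function.comp, offDiag, Fin.sum_univ_three]
      omega
    · rw [toeplitzKernel, pow_zero, mul_one, one_mul]
      split_ifs
      · rfl
      · exact norm_zero.trans_le (norm_nonneg _)
  · by_contra! hlt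
    simp only [offDiag, Fin.sum_univ_three] at hlt
    refine hz (sub_eq_zero.2 (ite_congr (propext ?_) (fun _ => ?_) fun _ => rfl))
    · obtain rfl | rfl | rfl : i = 0 ∨ i = 1 ∨ i = 2 := by omega
      all_goals
        simp only [IsLabel, shift, Pi.add_apply, Pi.single_apply, Fin.reduceEq, if_true, if_false]
        omega
    · simp only [shift, Pi.add_apply, add_sub_add_right_eq_sub]

theorem smoothOp_of_mem_smoothAlg {a : H →L[ℂ] H} (ha : a ∈ smoothAlg) : SmoothOp a := by
  obtain ⟨F, c, hF, hc, h⟩ := exists_opKernel_eq_of_mem_smoothAlg ha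
  rw [SmoothOp, h]
  exact (smoothKernel_compactKernel hF).add (smoothKernel_toeplitzKernel hc)

/-! ### Commutators with `D` -/

/-- The indicator function of the points at which `D` is positive. -/
def posIndicator (p : Pt) : ℤ := if p 2 = 0 ∧ 0 ≤ p 1 then 1 else 0

/-- The extension of the eigenvalues of `D` to the lattice. -/
def signedLength (p : Pt) : ℤ := ptLength p * (2 * posIndicator p - 1)

theorem diracEig_eq (t : Idx) : diracEig t = signedLength t.toPt := by
  rw [signedLength, ptLength_toPt, diracEig, posIndicator]
  obtain ⟨N, x, y, hx, hy⟩ := t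
  by_cases h : x = N
  · rw [if_pos h, if_pos]
    · push_cast
      ring
    · simp only [Idx.toPt, labelPt, Matrix.cons_val]
      omega
  · rw [if_neg h, if_neg]
    · push_cast
      ring
    · simp only [Idx.toPt, labelPt, Matrix.cons_val]
      omega

theorem dirac_eq : dirac = diagOp fun t => (signedLength t.toPt : ℂ) := by
  simp only [dirac, diracEig_eq, Complex.ofReal_intCast]

theorem SmoothKernel.posIndicator_mul {K : Pt × Pt → ℂ} (hK : SmoothKernel K) :
    SmoothKernel ((fun z => (posIndicator z.1 : ℂ)) * K) := by
  refine hK.mul 1 (fun z => ?_) fun i z h => ?_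
  · have offDiag_nonneg : (0 : ℝ) ≤ offDiag z := Nat.cast_nonneg _
    rw [posIndicator, Nat.cast_one, one_mul]
    split_ifs
    · rw [Int.cast_one, norm_one]
      linarith [offDiag_nonneg]
    · rw [Int.cast_zero, norm_zero]
      linarith [offDiag_nonneg]
  · contrapose! h
    refine sub_eq_zero.2 (congrArg Int.cast (if_congr ?_ rfl rfl))
    obtain rfl | rfl | rfl : i = 0 ∨ i = 1 ∨ i = 2 := by omega
    all_goals
      simp only [shift, Pi.add_apply, Pi.single_apply, Fin.reduceEq, if_true, if_false]
      omega

/-- The value of `D` is multiplied by `-1` between two points of which exactly one carries the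
indicator; the jump is the resulting part of the multiplier of `[D, ·]`. -/
def jump (z : Pt × Pt) : ℤ := (posIndicator z.1 - posIndicator z.2) * ptLength z.2

theorem diffMultiplier_signedLength (z : Pt × Pt) : diffMultiplier signedLength z =
    (2 * posIndicator z.1 - 1) * diffMultiplier ptLength z + 2 * jump z := by
  simp only [diffMultiplier, signedLength, jump]
  push_cast
  ring

-- On the support of a compact kernel, the indicator can only change between two points whose second
-- coordinates have opposite signs and whose third coordinates vanish.
theorem le_of_jump_mul_compactKernel_ne_zero {F : ℕ × ℕ × ℤ → ℂ} {z : Pt × Pt}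
    (hz : jump z * compactKernel F z ≠ 0) : (z.1 1).natAbs ≤ offDiag z ∧ z.1 2 = 0 ∧
      (jump z).natAbs ≤ dirWeight 0 z := by
  have jump_ne_zero : posIndicator z.1 - posIndicator z.2 ≠ 0 :=
    left_ne_zero_of_mul (Int.cast_ne_zero.1 (left_ne_zero_of_mul hz))
  have h : IsLabel z.1 ∧ IsLabel z.2 ∧ z.1 2 = z.2 2 := by
    by_contra h
    exact right_ne_zero_of_mul hz (if_neg h)
  simp only [IsLabel] at h
  simp only [posIndicator] at jump_ne_zero
  simp only [jump, posIndicator, dirWeight, offDiag, Fin.sum_univ_three, ptLength]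
  split_ifs at jump_ne_zero ⊢ <;> omega

theorem smoothKernel_jump_mul_compactKernel {F : ℕ × ℕ × ℤ → ℂ} (hF : Rapid fourierWeight F) :
    SmoothKernel ((fun z => (jump z : ℂ)) * compactKernel F) := by
  refine .of_rapid ((rapid_compactKernel hF).of_le 2 1 1 (fun z hz => ?_) fun z => ?_)
  · obtain ⟨h1, h2, -⟩ := le_of_jump_mul_compactKernel_ne_zero hz
    simp only [dirWeight, Fin.sum_univ_three, h2, Int.natAbs_zero]
    omega
  · rw [pow_one, one_mul]
    by_cases hz : jump z * compactKernel F z = 0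
    · rw [Pi.mul_apply, hz, norm_zero]
      positivity
    · have jump_le : ((jump z).natAbs : ℝ) ≤ dirWeight 0 z :=
        mod_cast (le_of_jump_mul_compactKernel_ne_zero hz).2.2
      rw [Pi.mul_apply, norm_mul, Complex.norm_intCast, ← Int.cast_abs, ← Nat.cast_natAbs]
      gcongr
      linarith

theorem jump_mul_toeplitzKernel (c : ℤ → ℂ) (z : Pt × Pt) : jump z * toeplitzKernel c z = 0 := by
  by_cases hz : z.1 1 = z.2 1 ∧ z.1 2 = z.2 2
  · rw [jump, posIndicator, posIndicator, hz.1, hz.2, sub_self, zero_mul, Int.cast_zero, zero_mul]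
  · rw [toeplitzKernel, if_neg (by tauto), mul_zero]

theorem smoothKernel_diffMultiplier_signedLength_mul {a : H →L[ℂ] H} (ha : a ∈ smoothAlg) :
    SmoothKernel (diffMultiplier signedLength * opKernel a) := by
  have smoothKernel_absDirac : SmoothKernel (diffMultiplier ptLength * opKernel a) :=
    SmoothKernel.diffMultiplier_ptLength_mul (smoothOp_of_mem_smoothAlg ha)
  obtain ⟨F, c, hF, -, h⟩ := exists_opKernel_eq_of_mem_smoothAlg ha
  have decomposition : diffMultiplier signedLength * opKernel a =
      (2 : ℂ) • ((fun z => (posIndicator z.1 : ℂ)) * (diffMultiplier ptLength * opKernel a))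
      + (-1 : ℂ) • (diffMultiplier ptLength * opKernel a)
      + (2 : ℂ) • ((fun z => (jump z : ℂ)) * compactKernel F) := by
    ext z
    have opKernel_z := congrFun h z
    simp only [Pi.add_apply, Pi.mul_apply, Pi.smul_apply, smul_eq_mul,
      diffMultiplier_signedLength] at opKernel_z ⊢
    linear_combination (2 * jump z : ℂ) * opKernel_z + 2 * jump_mul_toeplitzKernel c z
  rw [decomposition]
  exact ((smoothKernel_absDirac.posIndicator_mul.const_smul _).add
    (smoothKernel_absDirac.const_smul _)).add
      ((smoothKernel_jump_mul_compactKernel hF).const_smul _)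

theorem exists_isCommutator_dirac {a : H →L[ℂ] H} (ha : a ∈ smoothAlg) :
    ∃ da, IsCommutator dirac a da := by
  rw [dirac_eq]
  exact exists_isCommutator_diagOp_toPt (smoothKernel_diffMultiplier_signedLength_mul ha)

theorem smoothOp_of_isCommutator_dirac {a da : H →L[ℂ] H} (ha : a ∈ smoothAlg)
    (h : IsCommutator dirac a da) : SmoothOp da := by
  rw [dirac_eq, isCommutator_diagOp_toPt] at h
  rw [SmoothOp, h]
  exact smoothKernel_diffMultiplier_signedLength_mul ha

theorem smoothOp_one : SmoothOp 1 := by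
  have : opKernel 1 = toeplitzKernel (Pi.single 0 1) := by
    ext z
    rw [opKernel_one, toeplitzKernel]
    simp only [Pi.single_apply, ← ite_and]
    refine if_congr ?_ rfl rfl
    simp only [IsLabel, pt_ext_iff]
    omega
  rw [SmoothOp, this]
  refine smoothKernel_toeplitzKernel fun r => ⟨1, fun n => ?_⟩
  by_cases hn : n = 0
  · simp [hn]
  · simp [hn]

theorem smoothOp_of_mem_algB {b : H →L[ℂ] H} (hb : b ∈ algB) : SmoothOp b := by
  induction hb using Algebra.adjoin_induction with
  | mem x hx =>
    obtain ⟨a, ha, k, h | ⟨da, hda, h⟩⟩ := hx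
    · exact (smoothOp_of_mem_smoothAlg ha).of_isDelta h
    · exact (smoothOp_of_isCommutator_dirac ha hda).of_isDelta h
  | algebraMap r =>
    rw [Algebra.algebraMap_eq_smul_one]
    exact smoothOp_one.const_smul r
  | add x y _ _ hx hy => exact hx.add hy
  | mul x y _ _ hx hy => exact hx.mul hy

/-! ### Summation over the levels of `|D|` -/

/-- The basis of `H` arranged by the eigenvalues of `|D|`: level `n` consists of `(n + 1) ^ 2`
vectors. -/
def levelEquiv :
    (Σ n : ℕ, ↥(Finset.range (n + 1) ×ˢ Finset.range (n + 1))) ≃ Idx where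
  toFun z := ⟨z.1, z.2.1.1, z.2.1.2, Nat.le_of_lt_succ (Finset.mem_range.1 (Finset.mem_product.1
    z.2.2).1), Nat.le_of_lt_succ (Finset.mem_range.1 (Finset.mem_product.1 z.2.2).2)⟩
  invFun t := ⟨t.N, (t.x, t.y), Finset.mk_mem_product (Finset.mem_range_succ_iff.2 t.hx)
    (Finset.mem_range_succ_iff.2 t.hy)⟩
  left_inv _ := rfl
  right_inv _ := rfl

/-- The sum of the values of `G` at the points of the basis vectors with `|D|`-eigenvalue `n`. -/
def levelSum (G : Pt → ℂ) (n : ℕ) : ℂ :=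
  ∑ z ∈ Finset.range (n + 1) ×ˢ Finset.range (n + 1), G (labelPt n z.1 z.2)

theorem hasSum_levelSum {G : Pt → ℂ} {W : ℕ → ℂ} {A : ℂ}
    (h : HasSum (fun t : Idx => G t.toPt * W t.N) A) : HasSum (fun n => levelSum G n * W n) A := by
  simp only [levelSum, Finset.sum_mul]
  exact (levelEquiv.hasSum_iff.2 h).sigma fun n =>
    Finset.hasSum (Finset.range (n + 1) ×ˢ Finset.range (n + 1)) fun z =>
      G (labelPt n z.1 z.2) * W n

theorem summable_comp_level {W : ℕ → ℝ} (hW : 0 ≤ W)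
    (h : Summable fun n : ℕ => ((n : ℝ) + 1) ^ 2 * W n) : Summable fun t : Idx => W t.N := by
  refine levelEquiv.summable_iff.1 ((summable_sigma_of_nonneg fun z => hW z.1).2 ?_)
  refine ⟨fun n => Summable.of_finite, ?_⟩
  simpa [levelEquiv, sq] using h

theorem simplexSum_fin_three (g : (Fin 3 → ℕ) → ℂ) (n : ℕ) : simplexSum g n =
    ∑ z ∈ Finset.range (n + 1) ×ˢ Finset.range (n + 1) with z.2 ≤ z.1,
      g ![z.2, z.1 - z.2, n - z.1] := by
  refine (Finset.sum_nbij' (fun z => ![z.2, z.1 - z.2, n - z.1]) (fun a => (a 0 + a 1, a 0))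
    (fun z hz => ?_) (fun a ha => ?_) (fun z hz => ?_) (fun a ha => funext fun (i : Fin 3) => ?_)
    fun _ _ => rfl).symm
  all_goals
    simp only [Finset.mem_filter, Finset.mem_product, Finset.mem_range, Finset.mem_piAntidiag,
      Fin.sum_univ_three, Finset.mem_univ, implies_true, and_true, Matrix.cons_val,
      Prod.ext_iff] at *
  · omega
  · omega
  · omega
  · obtain rfl | rfl | rfl : i = 0 ∨ i = 1 ∨ i = 2 := by omega
    all_goals simp only [Matrix.cons_val] <;> omega

/-- The symmetry of the lattice which exchanges the points with negative second coordinate and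
those with nonnegative second coordinate. -/
def reflect (p : Pt) : Pt := ![p 0, -1 - p 1, p 2]

theorem levelSum_succ (G : Pt → ℂ) (n : ℕ) : levelSum G (n + 1) =
    simplexSum (fun a : Fin 3 → ℕ => G fun i => a i) (n + 1)
      + simplexSum (fun a : Fin 3 → ℕ => G (reflect fun i => a i)) n := by
  rw [levelSum, ← Finset.sum_filter_add_sum_filter_not _ fun z : ℕ × ℕ => z.2 ≤ z.1,
    simplexSum_fin_three, simplexSum_fin_three]
  congr 1
  · refine Finset.sum_congr rfl fun z hz => congrArg G (pt_ext_iff.2 ?_)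
    simp only [Finset.mem_filter, Finset.mem_product, Finset.mem_range] at hz
    simp only [labelPt, Matrix.cons_val]
    omega
  · refine Finset.sum_nbij' (fun z => (z.2 - 1, z.1)) (fun z => (z.2, z.1 + 1)) (fun z hz => ?_)
      (fun z hz => ?_) (fun z hz => ?_) (fun z hz => ?_)
      fun z hz => congrArg G (pt_ext_iff.2 ?_)
    all_goals
      simp only [Finset.mem_filter, Finset.mem_product, Finset.mem_range, labelPt, reflect,
        Matrix.cons_val, Prod.ext_iff, true_and, and_true] at *
      omega

theorem exists_rapid_simplexSum_natCast {ι : Type*} [Fintype ι] [DecidableEq ι]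
    {G : (ι → ℤ) → ℂ} (h0 : Rapid 0 G)
    (h : ∀ i, Rapid (fun p => (p i).natAbs) fun p => G (p + Pi.single i 1) - G p) :
    ∃ c : ℕ → ℂ, Rapid id (simplexSum (fun a : ι → ℕ => G fun i => a i) - fun n =>
      ∑ j ∈ Finset.range (Fintype.card ι), c j * ((n + j).choose j : ℂ)) := by
  refine exists_rapid_simplexSum_sub_sum_choose (h0.comp fun (a : ι → ℕ) i => (a i : ℤ)) fun i => ?_
  convert (h i).comp fun (a : ι → ℕ) i => (a i : ℤ) using 1
  · ext a
    simp only [Function.comp_apply, Int.natAbs_natCast]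
  · ext a
    simp only [Function.comp_apply]
    congr 2
    ext j
    simp only [Pi.add_apply, Pi.single_apply]
    split_ifs <;> push_cast <;> rfl

theorem rapid_reflect {G : Pt → ℂ}
    (h : ∀ i, Rapid (fun p => (p i).natAbs) fun p => G (p + Pi.single i 1) - G p) (i : Fin 3) :
    Rapid (fun p : Pt => (p i).natAbs) fun p =>
      (G ∘ reflect) (p + Pi.single i 1) - (G ∘ reflect) p := by
  by_cases hi : i = 1
  · subst hi
    have moved := ((h 1).comp fun p : Pt => reflect (p + Pi.single 1 1)).neg
    convert moved.of_weight_le (w' := fun p : Pt => (p 1).natAbs) 3 fun p _ => ?_ using 1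
    · ext p
      have : reflect (p + Pi.single 1 1) + Pi.single 1 1 = reflect p := pt_ext_iff.2 (by
        simp [reflect, sub_add_eq_sub_sub])
      simp only [Pi.neg_apply, Function.comp_apply, this, neg_sub]
    · simp only [Function.comp_apply, reflect, Matrix.cons_val, Pi.add_apply, Pi.single_eq_same]
      omega
  · convert (h i).comp reflect using 1
    · ext p
      obtain rfl | rfl : i = 0 ∨ i = 2 := by omega
      all_goals rfl
    · ext p
      have : reflect (p + Pi.single i 1) = reflect p + Pi.single i 1 := pt_ext_iff.2 (by
        obtain rfl | rfl : i = 0 ∨ i = 2 := by omega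
        all_goals simp [reflect])
      simp only [Function.comp_apply, this]

theorem Rapid.of_comp_succ {E : Type*} [SeminormedAddCommGroup E] {f : ℕ → E}
    (hf : Rapid id fun n => f (n + 1)) : Rapid id f := by
  intro r
  obtain ⟨C, hC⟩ := hf r
  refine ⟨‖f 0‖ + 2 ^ r * C, fun n => ?_⟩
  have hC0 : 0 ≤ C := (by positivity : (0 : ℝ) ≤ _).trans (hC 0)
  rcases n with _ | n
  · simp only [id, Nat.cast_zero, add_zero, one_pow, one_mul]
    exact le_add_of_nonneg_right (by positivity)
  · calc (1 + ((n + 1 : ℕ) : ℝ)) ^ r * ‖f (n + 1)‖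
        ≤ (2 * (1 + (n : ℝ))) ^ r * ‖f (n + 1)‖ := by
          gcongr
          push_cast
          linarith
      _ = 2 ^ r * ((1 + (n : ℝ)) ^ r * ‖f (n + 1)‖) := by rw [mul_pow, mul_assoc]
      _ ≤ 2 ^ r * C := by gcongr; exact hC n
      _ ≤ ‖f 0‖ + 2 ^ r * C := le_add_of_nonneg_left (norm_nonneg _)

theorem exists_quadratic_levelSum {G : Pt → ℂ} (h0 : Rapid 0 G)
    (h : ∀ i, Rapid (fun p => (p i).natAbs) fun p => G (p + Pi.single i 1) - G p) :
    ∃ l₃ l₂ l₁ : ℂ, Rapid id fun n => levelSum G n - (l₃ * n ^ 2 + l₂ * n + l₁) := by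
  obtain ⟨c, hc⟩ := exists_rapid_simplexSum_natCast h0 h
  obtain ⟨d, hd⟩ := exists_rapid_simplexSum_natCast (h0.comp reflect) (rapid_reflect h)
  refine ⟨(c 2 + d 2) / 2, (3 * c 2 + d 2) / 2 + c 1 + d 1, c 2 + c 1 + c 0 + d 0,
    Rapid.of_comp_succ ?_⟩
  have hc_succ := (hc.comp Nat.succ).of_weight_le (w' := id) 1 fun n _ => by
    simp only [Function.comp_apply, id]
    omega
  convert hc_succ.add hd using 1
  ext n
  simp only [Fintype.card_fin, Finset.sum_range_succ, Finset.sum_range_zero, Pi.add_apply,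
    Pi.sub_apply, Function.comp_apply, levelSum_succ, Nat.succ_eq_add_one, Nat.cast_choose_two,
    Nat.choose_one_right, Nat.choose_zero_right]
  push_cast
  ring

theorem SmoothOp.exists_quadratic_levelSum {b : H →L[ℂ] H} (hb : SmoothOp b) : ∃ l₃ l₂ l₁ : ℂ,
    Rapid id fun n => levelSum (fun p => opKernel b (p, p)) n - (l₃ * n ^ 2 + l₂ * n + l₁) := by
  refine QuantumSU2.exists_quadratic_levelSum
    ((hb.rapid.comp fun p : Pt => (p, p)).of_weight_le 1 fun p _ => by
      simp only [Pi.zero_apply]; omega) fun i => ?_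
  refine ((hb.diff i).comp fun p : Pt => (p, p)).of_weight_le 1 fun p _ => ?_
  simp only [Function.comp_apply, dirWeight]
  omega

theorem levelSum_opKernel_one (n : ℕ) :
    levelSum (fun p => opKernel 1 (p, p)) n = (n + 1) ^ 2 := by
  have diagonal (z) (hz : z ∈ Finset.range (n + 1) ×ˢ Finset.range (n + 1)) :
      opKernel 1 (labelPt n z.1 z.2, labelPt n z.1 z.2) = 1 := by
    simp only [Finset.mem_product, Finset.mem_range_succ_iff] at hz
    rw [opKernel_one, if_pos ⟨isLabel_toPt ⟨n, z.1, z.2, hz.1, hz.2⟩, rfl⟩]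
  rw [levelSum, Finset.sum_congr rfl diagonal]
  simp [sq]

/-! ### Traces -/

theorem absDiracNegPow_e {ε : ℝ} (hε : 0 < ε) {s : ℂ} (hs : 0 ≤ s.re) (t : Idx) :
    absDiracNegPow ε s (e t) = ((absDiracEig ε t : ℝ) : ℂ) ^ (-s) • e t :=
  H_ext fun i => (absDiracNegPow_apply hε hs _ i).trans
    (mul_e_apply (fun t => ((absDiracEig ε t : ℝ) : ℂ) ^ (-s)) i t)

theorem absDiracEig_eq (ε : ℝ) (t : Idx) : absDiracEig ε t = if t.N = 0 then ε else t.N := by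
  simp only [absDiracEig, abs_diracEig, Nat.cast_eq_zero]

theorem summable_absDiracEig (ε : ℝ) {s : ℂ} (hs : 3 < s.re) :
    Summable fun t : Idx => ‖((absDiracEig ε t : ℝ) : ℂ) ^ (-s)‖ := by
  simp only [absDiracEig_eq]
  refine summable_comp_level (W := fun n => ‖((if n = 0 then ε else n : ℝ) : ℂ) ^ (-s)‖)
    (fun _ => norm_nonneg _) ?_
  rw [← summable_nat_add_iff 1]
  have dominating : Summable fun n : ℕ => 4 * ((n + 1 : ℕ) : ℝ) ^ (2 - s.re) :=
    ((summable_nat_add_iff 1).2 (Real.summable_nat_rpow.2 (by linarith))).mul_left 4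
  refine dominating.of_nonneg_of_le (fun _ => by positivity) fun n => ?_
  have pos : (0 : ℝ) < ((n + 1 : ℕ) : ℝ) := by positivity
  rw [if_neg n.succ_ne_zero, Complex.norm_cpow_eq_rpow_re_of_pos pos, Complex.neg_re,
    sub_eq_add_neg, Real.rpow_add pos, ← mul_assoc, Real.rpow_two]
  gcongr
  push_cast
  nlinarith [Nat.cast_nonneg (α := ℝ) n]

theorem norm_absOp_apply {E : Type*} [NormedAddCommGroup E] [InnerProductSpace ℂ E]
    [CompleteSpace E] (T : E →L[ℂ] E) (ξ : E) : ‖absOp T ξ‖ = ‖T ξ‖ := by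
  have self_adjoint : star (CFC.abs T) = CFC.abs T := (CFC.abs_nonneg T).isSelfAdjoint
  have h : ⟪absOp T ξ, absOp T ξ⟫_ℂ = ⟪T ξ, T ξ⟫_ℂ := by
    rw [← inner_star_right (absOp T), ← inner_star_right T, absOp, self_adjoint]
    exact congrArg (fun S : E →L[ℂ] E => ⟪ξ, S ξ⟫_ℂ) (CFC.abs_mul_abs T)
  rw [inner_self_eq_norm_sq_to_K, inner_self_eq_norm_sq_to_K] at h
  exact (sq_eq_sq₀ (norm_nonneg _) (norm_nonneg _)).1 (by exact_mod_cast h)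

theorem norm_e (t : Idx) : ‖e t‖ = 1 := by
  classical
  rw [e, lp.norm_single (by norm_num), norm_one]

theorem norm_apply_e_le (b : H →L[ℂ] H) (t : Idx) : ‖b (e t)‖ ≤ ‖b‖ := by
  simpa only [norm_e, mul_one] using b.le_opNorm (e t)

theorem isTraceClass_mul_absDiracNegPow (b : H →L[ℂ] H) {ε : ℝ} (hε : 0 < ε) {s : ℂ}
    (hs : 3 < s.re) : IsTraceClass (b * absDiracNegPow ε s) := by
  refine Summable.of_norm_bounded ((summable_absDiracEig ε hs).mul_right ‖b‖) fun t => ?_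
  refine (norm_inner_le_norm _ _).trans ?_
  rw [norm_e, one_mul, norm_absOp_apply, mul_apply_eq_comp,
    absDiracNegPow_e hε (by linarith), map_smul, norm_smul]
  gcongr
  exact norm_apply_e_le b t

theorem hasSum_zetaFun (b : H →L[ℂ] H) {ε : ℝ} (hε : 0 < ε) {s : ℂ} (hs : 3 < s.re) :
    HasSum (fun n => levelSum (fun p => opKernel b (p, p)) n
      * ((if n = 0 then ε else n : ℝ) : ℂ) ^ (-s)) (zetaFun ε b s) := by
  refine hasSum_levelSum (W := fun n => ((if n = 0 then ε else n : ℝ) : ℂ) ^ (-s)) ?_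
  simp only [← absDiracEig_eq]
  have diagonal (t : Idx) : ⟪e t, (b * absDiracNegPow ε s) (e t)⟫_ℂ
      = opKernel b (t.toPt, t.toPt) * ((absDiracEig ε t : ℝ) : ℂ) ^ (-s) := by
    rw [mul_apply_eq_comp, absDiracNegPow_e hε (by linarith), map_smul,
      inner_smul_right, inner_e, opKernel_toPt, mul_comm]
  rw [zetaFun, opTrace, tsum_congr diagonal]
  refine Summable.hasSum (Summable.of_norm_bounded ((summable_absDiracEig ε hs).mul_left ‖b‖)
    fun t => ?_)
  rw [norm_mul, opKernel_toPt]
  gcongr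
  exact (lp.norm_apply_le_norm (by norm_num) _ _).trans (norm_apply_e_le b t)

/-! ### Zeta functions -/

theorem zetaFun_eq_LSeries (b : H →L[ℂ] H) {ε : ℝ} (hε : 0 < ε) {s : ℂ} (hs : 3 < s.re) :
    zetaFun ε b s = levelSum (fun p => opKernel b (p, p)) 0 * (ε : ℂ) ^ (-s)
      + LSeries (levelSum fun p => opKernel b (p, p)) s := by
  have h := hasSum_zetaFun b hε hs
  rw [← h.tsum_eq, h.summable.tsum_eq_add_tsum_ite 0, if_pos rfl, LSeries]
  refine congrArg _ (tsum_congr fun n => ?_)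
  rw [LSeries.term_def]
  refine ite_congr rfl (fun _ => rfl) fun hn => ?_
  rw [if_neg hn, Complex.ofReal_natCast, Complex.cpow_neg, div_eq_mul_inv]

theorem LSeriesHasSum_natCast_pow {s : ℂ} {j : ℕ} (hs : j + 1 < s.re) :
    LSeriesHasSum (fun n => (n : ℂ) ^ j) s (riemannZeta (s - j)) := by
  have hs' : 1 < (s - j).re := by
    rw [Complex.sub_re, Complex.natCast_re]
    linarith
  have shift : LSeries.term (fun n => (n : ℂ) ^ j) s = LSeries.term 1 (s - j) := by
    ext n
    rw [LSeries.term_def, LSeries.term_def]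
    refine ite_congr rfl (fun _ => rfl) fun hn => ?_
    rw [Pi.one_apply, Complex.cpow_sub _ _ (Nat.cast_ne_zero.2 hn), Complex.cpow_natCast,
      one_div_div]
  rw [LSeriesHasSum, shift]
  exact LSeriesHasSum_one hs'

theorem Rapid.abscissaOfAbsConv_eq_bot {r : ℕ → ℂ} (hr : Rapid id r) :
    LSeries.abscissaOfAbsConv r = ⊥ := by
  refine (EReal.eq_bot_iff_forall_lt _).2 fun y => ?_
  obtain ⟨k, hk⟩ := exists_nat_gt (-y + 1)
  obtain ⟨C, hC0, hC⟩ := hr.exists_norm_le_mul_inv k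
  refine (LSeries.abscissaOfAbsConv_le_of_le_const_mul_rpow (x := -(k : ℝ))
    ⟨C, fun n hn => (hC n).trans ?_⟩).trans_lt ?_
  · have hn' : (0 : ℝ) < n := Nat.cast_pos.2 (Nat.pos_of_ne_zero hn)
    rw [Real.rpow_neg hn'.le, Real.rpow_natCast]
    simp only [id]
    gcongr
    linarith
  · have : -(k : ℝ) + 1 < y := by linarith
    exact_mod_cast this

theorem Rapid.LSeriesSummable {r : ℕ → ℂ} (hr : Rapid id r) (s : ℂ) : LSeriesSummable r s :=
  LSeriesSummable_of_abscissaOfAbsConv_lt_re (hr.abscissaOfAbsConv_eq_bot ▸ EReal.bot_lt_coe s.re)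

theorem Rapid.differentiable_LSeries {r : ℕ → ℂ} (hr : Rapid id r) :
    Differentiable ℂ (LSeries r) := fun s =>
  (LSeries_hasDerivAt (hr.abscissaOfAbsConv_eq_bot ▸ EReal.bot_lt_coe s.re)).differentiableAt

theorem LSeries_eq_of_rapid_sub_quadratic {f : ℕ → ℂ} {l₃ l₂ l₁ : ℂ}
    (h : Rapid id fun n => f n - (l₃ * n ^ 2 + l₂ * n + l₁)) {s : ℂ} (hs : 3 < s.re) :
    LSeries f s = l₃ * riemannZeta (s - 2) + l₂ * riemannZeta (s - 1) + l₁ * riemannZeta s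
      + LSeries (fun n => f n - (l₃ * n ^ 2 + l₂ * n + l₁)) s := by
  have h₃ := (LSeriesHasSum_natCast_pow (s := s) (j := 2) (by push_cast; linarith)).smul l₃
  have h₂ := (LSeriesHasSum_natCast_pow (s := s) (j := 1) (by push_cast; linarith)).smul l₂
  have h₁ := (LSeriesHasSum_natCast_pow (s := s) (j := 0) (by push_cast; linarith)).smul l₁
  have LSeries_eq := (((h₃.add h₂).add h₁).add (h.LSeriesSummable s).LSeriesHasSum).LSeries_eq
  simp only [Nat.cast_ofNat, Nat.cast_one, Nat.cast_zero, sub_zero] at LSeries_eq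
  rw [← LSeries_eq]
  refine congrArg (LSeries · s) (funext fun n => ?_)
  simp only [Pi.add_apply, Pi.smul_apply, smul_eq_mul]
  ring

theorem exists_entire_zetaFun_eq {b : H →L[ℂ] H} {l₃ l₂ l₁ : ℂ}
    (h : Rapid id fun n => levelSum (fun p => opKernel b (p, p)) n - (l₃ * n ^ 2 + l₂ * n + l₁))
    {ε : ℝ} (hε : 0 < ε) : ∃ ρ : ℂ → ℂ, Differentiable ℂ ρ ∧ ∀ s : ℂ, 3 < s.re →
      zetaFun ε b s = l₃ * riemannZeta (s - 2) + l₂ * riemannZeta (s - 1)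
        + l₁ * riemannZeta s + ρ s := by
  have entire_cpow : Differentiable ℂ fun s : ℂ => (ε : ℂ) ^ (-s) :=
    differentiable_id.neg.const_cpow (Or.inl (Complex.ofReal_ne_zero.2 hε.ne'))
  refine ⟨_, (entire_cpow.const_mul (levelSum (fun p => opKernel b (p, p)) 0)).add
    h.differentiable_LSeries, fun s hs => ?_⟩
  rw [zetaFun_eq_LSeries b hε hs, LSeries_eq_of_rapid_sub_quadratic h hs]
  simp only [Pi.add_apply]
  ring

/-! ### Simple poles -/

open Filter Topology

/-- The rational function with simple poles of residues `r w` at the points `w` of `S`, which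
vanishes at infinity. -/
def polarSum (S : Finset ℂ) (r : ℂ → ℂ) (s : ℂ) : ℂ := ∑ w ∈ S, r w / (s - w)

theorem analyticOnNhd_polarSum (S : Finset ℂ) (r : ℂ → ℂ) :
    AnalyticOnNhd ℂ (polarSum S r) (S : Set ℂ)ᶜ := fun z hz => by
  refine Finset.analyticAt_fun_sum _ fun w hw =>
    analyticAt_const.div (analyticAt_id.sub analyticAt_const) (sub_ne_zero.2 ?_)
  rintro rfl
  exact hz hw

theorem meromorphic_polarSum (S : Finset ℂ) (r : ℂ → ℂ) : Meromorphic (polarSum S r) := fun z =>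
  MeromorphicAt.fun_sum fun w _ =>
    (MeromorphicAt.const (r w) z).div ((MeromorphicAt.id z).sub (MeromorphicAt.const w z))

theorem tendsto_sub_mul_of_continuousAt {f : ℂ → ℂ} {z : ℂ} (hf : ContinuousAt f z) :
    Tendsto (fun s => (s - z) * f s) (𝓝[≠] z) (𝓝 0) := by
  have h : ContinuousAt (fun s => (s - z) * f s) z :=
    (continuousAt_id.sub continuousAt_const).mul hf
  simpa only [sub_self, zero_mul] using h.tendsto.mono_left nhdsWithin_le_nhds

theorem tendsto_sub_mul_polarSum_add {S : Finset ℂ} {z : ℂ} (hz : z ∈ S) (r : ℂ → ℂ) {g : ℂ → ℂ}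
    (hg : ContinuousAt g z) :
    Tendsto (fun s => (s - z) * (polarSum S r s + g s)) (𝓝[≠] z) (𝓝 (r z)) := by
  have other_poles : ContinuousAt (polarSum (S.erase z) r) z :=
    (analyticOnNhd_polarSum _ _ z (by simp)).continuousAt
  have h := (tendsto_sub_mul_of_continuousAt (other_poles.add hg)).const_add (r z)
  rw [add_zero] at h
  refine h.congr' (eventually_nhdsWithin_of_forall fun s hs => ?_)
  have hs' : s - z ≠ 0 := sub_ne_zero.2 hs
  simp only [Pi.add_apply, polarSum, ← Finset.add_sum_erase S _ hz]
  field_simp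
  ring

theorem neg_one_le_meromorphicOrderAt_of_tendsto {f : ℂ → ℂ} {z c : ℂ} (hf : MeromorphicAt f z)
    (h : Tendsto (fun s => (s - z) * f s) (𝓝[≠] z) (𝓝 c)) : -1 ≤ meromorphicOrderAt f z := by
  have hz : MeromorphicAt (· - z) z := (MeromorphicAt.id z).sub (MeromorphicAt.const z z)
  have nonneg : 0 ≤ meromorphicOrderAt ((· - z) * f) z :=
    (tendsto_nhds_iff_meromorphicOrderAt_nonneg (hz.mul hf)).1 ⟨c, h⟩
  rw [meromorphicOrderAt_mul hz hf, meromorphicOrderAt_id_sub_const] at nonneg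
  cases hn : meromorphicOrderAt f z with
  | top => exact le_top
  | coe n =>
    rw [hn] at nonneg
    have : (0 : ℤ) ≤ 1 + n := by exact_mod_cast nonneg
    exact WithTop.coe_le_coe.2 (show (-1 : ℤ) ≤ n by omega)

theorem eqOn_of_eqOn_re_gt {S : Finset ℂ} {f g : ℂ → ℂ} (hf : AnalyticOnNhd ℂ f (S : Set ℂ)ᶜ)
    (hg : AnalyticOnNhd ℂ g (S : Set ℂ)ᶜ) {p : ℝ} (h : ∀ s : ℂ, p < s.re → s ∉ S → f s = g s) :
    Set.EqOn f g (S : Set ℂ)ᶜ := by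
  have preconnected : IsPreconnected (S : Set ℂ)ᶜ :=
    (S.countable_toSet.isConnected_compl_of_one_lt_rank
      (by rw [Complex.rank_real_complex]; norm_num)).isPreconnected
  have half_plane : IsOpen {s : ℂ | p < s.re} := isOpen_lt continuous_const Complex.continuous_re
  have base : ((p + 1 : ℝ) : ℂ) ∈ {s : ℂ | p < s.re} := lt_add_one p
  obtain ⟨s, hs, hsS⟩ := Filter.nonempty_of_mem (inter_mem
    (nhdsWithin_le_nhds (half_plane.mem_nhds base))
    (nhdsNE_le_cofinite ((p + 1 : ℝ) : ℂ) S.finite_toSet.compl_mem_cofinite))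
  refine hf.eqOn_of_preconnected_of_eventuallyEq hg preconnected hsS ?_
  filter_upwards [half_plane.mem_nhds hs, S.finite_toSet.isClosed.isOpen_compl.mem_nhds hsS]
    with s hs hsS using h s hs hsS

theorem residue_eq_zero_of_analyticOnNhd {S : Finset ℂ} {z : ℂ} (hz : z ∈ S) {r g Z : ℂ → ℂ}
    (hg : Differentiable ℂ g) (hZ : AnalyticOnNhd ℂ Z (insert z (S : Set ℂ)ᶜ)) {p : ℝ}
    (h : ∀ s : ℂ, p < s.re → s ∉ S → Z s = polarSum S r s + g s) : r z = 0 := by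
  have agree : Set.EqOn Z (polarSum S r + g) (S : Set ℂ)ᶜ :=
    eqOn_of_eqOn_re_gt (hZ.mono (Set.subset_insert _ _))
      ((analyticOnNhd_polarSum S r).add fun w _ => hg.analyticAt w) h
  refine tendsto_nhds_unique (tendsto_sub_mul_polarSum_add hz r hg.continuous.continuousAt)
    ((tendsto_sub_mul_of_continuousAt (hZ z (Set.mem_insert _ _)).continuousAt).congr' ?_)
  filter_upwards [nhdsNE_le_cofinite z S.finite_toSet.compl_mem_cofinite] with s hs
  rw [agree hs, Pi.add_apply]

theorem isSimpleDimensionSpectrum_of_polarSum {p : ℝ} {𝓕 : Set (ℂ → ℂ)} {S : Finset ℂ}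
    (extension : ∀ ζ ∈ 𝓕, ∃ r g : ℂ → ℂ, Differentiable ℂ g ∧
      ∀ s : ℂ, p < s.re → s ∉ S → ζ s = polarSum S r s + g s)
    (singular : ∀ z ∈ S, ∃ ζ ∈ 𝓕, ∃ r g : ℂ → ℂ, Differentiable ℂ g ∧ r z ≠ 0 ∧
      ∀ s : ℂ, p < s.re → s ∉ S → ζ s = polarSum S r s + g s) :
    IsSimpleDimensionSpectrum p 𝓕 S where
  isClosed := S.finite_toSet.isClosed
  isDiscrete := S.finite_toSet.isDiscrete
  extension ζ hζ := by
    obtain ⟨r, g, hg, h⟩ := extension ζ hζ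
    have meromorphic : Meromorphic (polarSum S r + g) := fun z =>
      (meromorphic_polarSum S r z).add (hg.analyticAt z).meromorphicAt
    exact ⟨polarSum S r + g, meromorphic,
      (analyticOnNhd_polarSum S r).add fun z _ => hg.analyticAt z,
      fun z hz => neg_one_le_meromorphicOrderAt_of_tendsto (meromorphic z)
        (tendsto_sub_mul_polarSum_add hz r hg.continuous.continuousAt),
      fun s hs hsS => (h s hs hsS).symm⟩
  singular z hz := by
    obtain ⟨ζ, hζ, r, g, hg, hr, h⟩ := singular z hz
    refine ⟨ζ, hζ, ?_⟩
    rintro ⟨Z, hZ, hZζ⟩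
    exact hr (residue_eq_zero_of_analyticOnNhd hz hg hZ fun s hs hsS =>
      (hZζ s hs hsS).trans (h s hs hsS))

/-! ### The dimension spectrum -/

/-- The residues of `l₃ ζ(s - 2) + l₂ ζ(s - 1) + l₁ ζ(s)` at its poles `3`, `2` and `1`. -/
def zetaResidue (l₃ l₂ l₁ w : ℂ) : ℂ := if w = 3 then l₃ else if w = 2 then l₂ else l₁

theorem exists_polarSum_zetaFun_eq {b : H →L[ℂ] H} {l₃ l₂ l₁ : ℂ}
    (h : Rapid id fun n => levelSum (fun p => opKernel b (p, p)) n - (l₃ * n ^ 2 + l₂ * n + l₁))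
    {ε : ℝ} (hε : 0 < ε) : ∃ g : ℂ → ℂ, Differentiable ℂ g ∧ ∀ s : ℂ, 3 < s.re →
      s ∉ ({1, 2, 3} : Finset ℂ) →
        zetaFun ε b s = polarSum {1, 2, 3} (zetaResidue l₃ l₂ l₁) s + g s := by
  obtain ⟨ρ, hρ, hζ⟩ := exists_entire_zetaFun_eq h hε
  refine ⟨fun s => l₃ * riemannZeta₀ (s - 2) + l₂ * riemannZeta₀ (s - 1)
    + l₁ * riemannZeta₀ s + ρ s, by fun_prop, fun s hs hs' => ?_⟩
  simp only [Finset.mem_insert, Finset.mem_singleton, not_or] at hs'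
  obtain ⟨ne_one, ne_two, ne_three⟩ := hs'
  have polar : polarSum {1, 2, 3} (zetaResidue l₃ l₂ l₁) s
      = l₁ / (s - 1) + (l₂ / (s - 2) + l₃ / (s - 3)) := by
    rw [polarSum, Finset.sum_insert (by norm_num), Finset.sum_insert (by norm_num),
      Finset.sum_singleton]
    norm_num [zetaResidue]
  rw [hζ s hs, polar, riemannZeta_eq_inv_sub_add ne_one,
    riemannZeta_eq_inv_sub_add (s := s - 1) (by rwa [ne_eq, sub_eq_iff_eq_add, one_add_one_eq_two]),
    riemannZeta_eq_inv_sub_add (s := s - 2) (by rw [ne_eq, sub_eq_iff_eq_add]; norm_num [ne_three])]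
  ring

theorem isSimpleDimensionSpectrum_zetaFun {ε : ℝ} (hε : 0 < ε) :
    IsSimpleDimensionSpectrum 3 {ζ | ∃ b ∈ algB, ζ = zetaFun ε b} {1, 2, 3} := by
  have levels_one : Rapid id fun n => levelSum (fun p => opKernel 1 (p, p)) n
      - (1 * n ^ 2 + 2 * n + 1) := by
    have vanish (n : ℕ) : ((n : ℂ) + 1) ^ 2 - (1 * n ^ 2 + 2 * n + 1) = 0 := by ring
    simp only [levelSum_opKernel_one, vanish]
    exact fun r => ⟨0, fun n => by rw [norm_zero, mul_zero]⟩
  have poles : ({1, 2, 3} : Set ℂ) = ({1, 2, 3} : Finset ℂ) := by push_cast; rfl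
  rw [poles]
  refine isSimpleDimensionSpectrum_of_polarSum ?_ fun z _ => ?_
  · rintro _ ⟨b, hb, rfl⟩
    obtain ⟨l₃, l₂, l₁, hl⟩ := (smoothOp_of_mem_algB hb).exists_quadratic_levelSum
    exact ⟨_, exists_polarSum_zetaFun_eq hl hε⟩
  · obtain ⟨g, hg, h⟩ := exists_polarSum_zetaFun_eq levels_one hε
    refine ⟨_, ⟨1, one_mem _, rfl⟩, zetaResidue 1 2 1, g, hg, ?_, h⟩
    unfold zetaResidue
    split_ifs <;> norm_num

end QuantumSU2

end

open QuantumSU2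

theorem theorem2 :
    -- the elements `a`, `[D, a]`, for `a ∈ 𝒜`, are in the domain of all the powers of `δ`
    (∀ a ∈ smoothAlg, ∃ da, IsCommutator dirac a da ∧
      ∀ k : ℕ, (∃ T, IsDelta k a T) ∧ ∃ T, IsDelta k da T) ∧
    -- `b |D|^{-s}` is of trace class for `b ∈ ℬ` and `Re s > 3`
    (∀ ε : ℝ, 0 < ε → ∀ b ∈ algB, ∀ s : ℂ, 3 < s.re →
      IsTraceClass (b * absDiracNegPow ε s)) ∧
    -- the dimension spectrum is simple and equal to `{1, 2, 3}`
    (∀ ε : ℝ, 0 < ε → IsSimpleDimensionSpectrum 3 {ζ | ∃ b ∈ algB, ζ = zetaFun ε b} {1, 2, 3}) ∧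
    -- the form of the zeta functions
    (∀ b ∈ algB, ∃ l₃ l₂ l₁ : ℂ, ∀ ε : ℝ, 0 < ε → ∃ ρ : ℂ → ℂ, Differentiable ℂ ρ ∧
      ∀ s : ℂ, 3 < s.re →
        zetaFun ε b s = l₃ * riemannZeta (s - 2) + l₂ * riemannZeta (s - 1)
          + l₁ * riemannZeta s + ρ s) := by
  refine ⟨fun a ha => ?_, fun ε hε b _ s hs => isTraceClass_mul_absDiracNegPow b hε hs,
    fun ε hε => isSimpleDimensionSpectrum_zetaFun hε, fun b hb => ?_⟩
  · obtain ⟨da, hda⟩ := exists_isCommutator_dirac ha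
    exact ⟨da, hda, fun k => ⟨(smoothOp_of_mem_smoothAlg ha).exists_isDelta k,
      (smoothOp_of_isCommutator_dirac ha hda).exists_isDelta k⟩⟩
  · obtain ⟨l₃, l₂, l₁, hl⟩ := (smoothOp_of_mem_algB hb).exists_quadratic_levelSum
    exact ⟨l₃, l₂, l₁, fun ε hε => exists_entire_zetaFun_eq hl hε⟩
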